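/- Let $G$ be a countable group. An $\mathbb R$-tree is a nonempty geodesic metric space in which any two distinct points $x,y$ are joined by a unique topological arc $[x,y]$ (and $[x,x]=\{x\}$). For an isometric action of $G$ on an $\mathbb R$-tree $T$, the length function is $\ell_T:G\to\mathbb R$, $\ell_T(g)=\min_{x\in T}d(x,gx)$; a map $\ell:G\to\mathbb R$ is called a length function if $\ell=\ell_T$ for some $\mathbb R$-tree $T$ with an isometric action of $G$. An element $g$ is hyperbolic in $T$ if it has no fixed point, and then $A(g)=\{x: d(x,gx)=\ell_T(g)\}$ is its axis. The tree $T$ is minimal if it contains no proper nonempty $G$-invariant subtree, and irreducible if there are hyperbolic $g,h\in G$ with $A(g)\cap A(h)$ compact. A collapse map is a $G$-equivariant map $f$ between such trees that preserves alignment: $f([x,y])=[f(x),f(y)]$ for all $x,y$ (where the right-hand side may be a point). Two $\mathbb R$-trees $T_1,T_2$ with isometric actions of $G$ are compatible if they have a common refinement: an $\mathbb R$-tree $R$ with an isometric action of $G$ and collapse maps $g_i:R\to T_i$, $i=1,2$. The standard common refinement $T_s$ obtained from $(R,g_1,g_2)$ is the metric space associated with the pseudo-distance $\delta(x,y)=d_1(g_1(x),g_1(y))+d_2(g_2(x),g_2(y))$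 on $R$, with the induced action and the induced maps $f_i:T_s\to T_i$. **Theorem.** Let $T_1,T_2$ be minimal irreducible $\mathbb R$-trees with isometric actions of $G$ and length functions $\ell_1,\ell_2$. Then $T_1$ and $T_2$ are compatible if and only if $\ell_1+\ell_2$ is a length function. Moreover, for any common refinement $(R,g_1,g_2)$ of $T_1$ and $T_2$, the space $T_s$ obtained from it is a minimal $\mathbb R$-tree, the maps $f_i:T_s\to T_i$ are collapse maps, and $T_s$ has length function $\ell_1+\ell_2$; and every minimal $\mathbb R$-tree with an isometric action of $G$ and length function $\ell_1+\ell_2$ is $G$-equivariantly isometric to $T_s$. -/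

import Mathlib

universe u v

namespace RTrees


section Trees

variable {T : Type*} [MetricSpace T]

/-- `s` is a topological arc joining `x` to `y`: the image of an injective continuous path. (By
compactness such a path is a homeomorphism from the unit interval onto `s`.) -/
def IsArc (x y : T) (s : Set T) : Prop :=
  ∃ γ : Path x y, Function.Injective γ ∧ Set.range γ = s

variable (T) in
/-- An `ℝ`-tree: a (nonempty) geodesic metric space in which any two distinct points are joined by
a unique topological arc. -/
structure IsRTree : Prop where
  nonempty : Nonempty T
  geodesic : ∀ x y : T, ∃ γ : ℝ → T, γ 0 = x ∧ γ (dist x y) = y ∧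
    ∀ s ∈ Set.Icc (0 : ℝ) (dist x y), ∀ t ∈ Set.Icc (0 : ℝ) (dist x y),
      dist (γ s) (γ t) = |s - t|
  unique_arc : ∀ x y : T, x ≠ y → ∃! s : Set T, IsArc x y s

/-- The arc `[x, y]` of an `ℝ`-tree, as a metric segment; it is `{x}` when `x = y`. In an
`ℝ`-tree it is the image of the geodesic from `x` to `y`, hence, when `x ≠ y`, the unique
topological arc from `x` to `y`. -/
def seg (x y : T) : Set T := {z | dist x z + dist z y = dist x y}

/-- A set containing the arc between any two of its points; subtrees are the nonempty such sets. -/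
def IsArcConvex (S : Set T) : Prop := ∀ x ∈ S, ∀ y ∈ S, seg x y ⊆ S

/-- `f` preserves alignment: the image of every arc `[x, y]` is the arc `[f x, f y]`, possibly
reduced to a point. -/
def PreservesAlignment {T' : Type*} [MetricSpace T'] (f : T → T') : Prop :=
  ∀ x y : T, f '' seg x y = seg (f x) (f y)

end Trees

section Actions

variable {G : Type*} [Group G]

/-- The translation length `ℓ_T(g)`, the minimum (attained in every `ℝ`-tree) of `d(x, gx)` over
`x ∈ T`. As a function of `g` it is the length function of `T`. -/
noncomputable def lengthFn (T : Type*) [MetricSpace T] [MulAction G T] (g : G) : ℝ :=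
  ⨅ x : T, dist x (g • x)

/-- The characteristic set `A(g)`, where the minimal displacement is achieved: the fixed point set
of an elliptic element, the axis of a hyperbolic one. -/
def charSet (T : Type*) [MetricSpace T] [MulAction G T] (g : G) : Set T :=
  {x | dist x (g • x) = lengthFn T g}

/-- `g` is hyperbolic: it fixes no point of `T`. -/
def IsHyperbolic (T : Type*) [MetricSpace T] [MulAction G T] (g : G) : Prop :=
  ∀ x : T, g • x ≠ x

variable (G) in
/-- The action is minimal: the only `G`-invariant subtree is the whole tree. -/
def IsMinimalTree (T : Type*) [MetricSpace T] [MulAction G T] : Prop :=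
  ∀ S : Set T, S.Nonempty → IsArcConvex S → (∀ (g : G), ∀ x ∈ S, g • x ∈ S) → S = Set.univ

variable (G) in
/-- The action is irreducible: there are hyperbolic elements whose axes have compact
intersection. -/
def IsIrreducibleTree (T : Type*) [MetricSpace T] [MulAction G T] : Prop :=
  ∃ g h : G, IsHyperbolic T g ∧ IsHyperbolic T h ∧ IsCompact (charSet T g ∩ charSet T h)

/-- `ℓ : G → ℝ` is a length function: it is the length function of some `ℝ`-tree with an isometric
action of `G`. -/
def IsLengthFunction (ℓ : G → ℝ) : Prop :=
  ∃ (T : Type u) (_ : MetricSpace T) (_ : MulAction G T) (_ : IsIsometricSMul G T),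
    IsRTree T ∧ ∀ g : G, ℓ g = lengthFn T g

variable (G) in
/-- Compatibility: there is an `ℝ`-tree with an isometric action of `G` and equivariant
alignment-preserving maps to `T₁` and `T₂` (a common refinement). -/
def Compatible (T₁ T₂ : Type u) [MetricSpace T₁] [MulAction G T₁]
    [MetricSpace T₂] [MulAction G T₂] : Prop :=
  ∃ (R : Type u) (_ : MetricSpace R) (_ : MulAction G R) (_ : IsIsometricSMul G R),
    IsRTree R ∧ ∃ (g₁ : R →[G] T₁) (g₂ : R →[G] T₂),
      PreservesAlignment g₁ ∧ PreservesAlignment g₂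

end Actions

section StandardRefinement

variable {G : Type*} [Group G] {R T₁ T₂ : Type*} [MulAction G R]
  [MetricSpace T₁] [MulAction G T₁] [MetricSpace T₂] [MulAction G T₂]

/-- A copy of `R`, to carry the pseudo-distance
`δ(x, y) = d₁(g₁ x, g₁ y) + d₂(g₂ x, g₂ y)`. -/
def SumSpace (_g₁ : R →[G] T₁) (_g₂ : R →[G] T₂) : Type _ := R

variable (g₁ : R →[G] T₁) (g₂ : R →[G] T₂)

noncomputable instance : PseudoMetricSpace (SumSpace g₁ g₂) where
  dist x y := dist (g₁ (show R from x)) (g₁ (show R from y)) +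
    dist (g₂ (show R from x)) (g₂ (show R from y))
  dist_self x := by simp
  dist_comm x y := by simp only [dist_comm]
  dist_triangle x y z := by
    have h₁ := dist_triangle (g₁ (show R from x)) (g₁ (show R from y)) (g₁ (show R from z))
    have h₂ := dist_triangle (g₂ (show R from x)) (g₂ (show R from y)) (g₂ (show R from z))
    linarith

instance : MulAction G (SumSpace g₁ g₂) := inferInstanceAs (MulAction G R)

theorem SumSpace.dist_def (x y : SumSpace g₁ g₂) :
    dist x y = dist (g₁ (show R from x)) (g₁ (show R from y)) +
      dist (g₂ (show R from x)) (g₂ (show R from y)) := rfl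

instance [IsIsometricSMul G T₁] [IsIsometricSMul G T₂] :
    IsIsometricSMul G (SumSpace g₁ g₂) where
  isometry_smul c := Isometry.of_dist_eq fun x y => by
    have e₁ : ∀ z : R, g₁ (c • z) = c • g₁ z := fun z => map_smul g₁ c z
    have e₂ : ∀ z : R, g₂ (c • z) = c • g₂ z := fun z => map_smul g₂ c z
    change dist (g₁ (c • (show R from x))) (g₁ (c • (show R from y))) +
      dist (g₂ (c • (show R from x))) (g₂ (c • (show R from y))) = _
    rw [e₁, e₁, e₂, e₂, dist_smul, dist_smul]
    rfl

/-- The standard common refinement `T_s` constructed from a common refinement `R` with maps `g₁`,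
`g₂`: the metric space associated with the pseudo-distance `δ`, i.e. the quotient of `R` by
`δ = 0`. -/
abbrev StdRefinement : Type _ := SeparationQuotient (SumSpace g₁ g₂)

instance [IsIsometricSMul G T₁] [IsIsometricSMul G T₂] :
    IsIsometricSMul G (StdRefinement g₁ g₂) where
  isometry_smul c := Isometry.of_dist_eq fun x y => by
    obtain ⟨x, rfl⟩ := SeparationQuotient.surjective_mk x
    obtain ⟨y, rfl⟩ := SeparationQuotient.surjective_mk y
    rw [← SeparationQuotient.mk_smul, ← SeparationQuotient.mk_smul,
      SeparationQuotient.dist_mk, SeparationQuotient.dist_mk, dist_smul]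

theorem SumSpace.eq_of_inseparable {x y : SumSpace g₁ g₂} (h : Inseparable x y) :
    g₁ (show R from x) = g₁ (show R from y) ∧ g₂ (show R from x) = g₂ (show R from y) := by
  have h' := Metric.inseparable_iff.1 h
  rw [SumSpace.dist_def] at h'
  constructor
  · exact dist_le_zero.1 (by linarith [dist_nonneg (x := g₂ (show R from x)) (y := g₂ y)])
  · exact dist_le_zero.1 (by linarith [dist_nonneg (x := g₁ (show R from x)) (y := g₁ y)])

variable [IsIsometricSMul G T₁] [IsIsometricSMul G T₂]

/-- The equivariant map `f₁ : T_s → T₁` induced by `g₁`. -/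
noncomputable def StdRefinement.fst : StdRefinement g₁ g₂ →[G] T₁ where
  toFun := SeparationQuotient.lift (fun x : SumSpace g₁ g₂ => g₁ (show R from x))
    fun _ _ h => (SumSpace.eq_of_inseparable g₁ g₂ h).1
  map_smul' c x := by
    obtain ⟨x, rfl⟩ := SeparationQuotient.surjective_mk x
    exact map_smul g₁ c (show R from x)

/-- The equivariant map `f₂ : T_s → T₂` induced by `g₂`. -/
noncomputable def StdRefinement.snd : StdRefinement g₁ g₂ →[G] T₂ where
  toFun := SeparationQuotient.lift (fun x : SumSpace g₁ g₂ => g₂ (show R from x))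
    fun _ _ h => (SumSpace.eq_of_inseparable g₁ g₂ h).2
  map_smul' c x := by
    obtain ⟨x, rfl⟩ := SeparationQuotient.surjective_mk x
    exact map_smul g₂ c (show R from x)

end StandardRefinement

end RTrees

/-! Everything rests on one property of betweenness in an ℝ-tree: a point of [x, y] lies on [x, w]
or on [w, y], for every w (`IsRTree.btw`). Conversely, this dichotomy and the interpolation of
distances characterize ℝ-trees (`isRTree_of_btw`). Collapse maps respect betweenness, so T_s
inherits both properties from R. A point x of T_s with gx on [x, g²x] has aligned images in T₁ and
T₂, where its displacement is again the translation length; hence lengths add.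

For the converse, let T realize ℓ = ℓ₁ + ℓ₂. Irreducibility yields g and k that are hyperbolic with
disjoint axes in both T₁ and T₂ (`exists_common_isFoot`). Disjointness shows in the lengths, as
ℓ(gk) > ℓ(g) + ℓ(k), so it also holds in T. Let [c, v] be the bridge from the axis of g to that of
k. The product of gⁱkg⁻ⁱ and y(gʲkg⁻ʲ)y⁻¹ has length at most 2ℓ(k) + 2(d(c, gⁱv) + d(c, yc) + d(c,
gʲv)), with equality if the path through c and yc does not backtrack. At each of these two points at
most one exponent among -1, 0, 1 backtracks, so two trees leave a common good choice among the
three. Comparing the trees gives d(c, yc) = d₁(c₁, yc₁) + d₂(c₂, yc₂) (`IsFoot.dist_eq_add`).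

The orbit of c thus carries the sum of two orbit metrics, and so do the medians of its points.
Gromov products in T₁ and T₂ are then bounded by those in T, which suffices to extend the orbit maps
to collapse maps on the hull of the orbit (`IsDominated.exists_extension`): the hull is a common
refinement. For uniqueness, c₁ and c₂ do not depend on T, so minimal trees with length function ℓ₁ +
ℓ₂ have isometric orbits; the same extension is then isometric, and onto by minimality. -/

namespace RTrees

open Set Filter Topology

/-! ### Metric segments -/

section Segments

variable {T : Type*} [MetricSpace T]

theorem mem_seg {x y z : T} : z ∈ seg x y ↔ dist x z + dist z y = dist x y := Iff.rfl

theorem left_mem_seg (x y : T) : x ∈ seg x y := by simp [mem_seg]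

theorem right_mem_seg (x y : T) : y ∈ seg x y := by simp [mem_seg]

theorem seg_self (x : T) : seg x x = {x} := by
  ext z
  simp only [mem_seg, dist_self, mem_singleton_iff]
  constructor
  · intro h
    exact dist_le_zero.1 (by linarith [dist_nonneg (x := x) (y := z)])
  · rintro rfl
    simp

theorem seg_symm {x y z : T} (h : z ∈ seg x y) : z ∈ seg y x := by
  simp only [mem_seg] at *
  linarith [dist_comm x y, dist_comm x z, dist_comm z y]

theorem seg_comm (x y : T) : seg x y = seg y x :=
  Subset.antisymm (fun _ => seg_symm) fun _ => seg_symm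

theorem mem_seg_of_mem_left {x y z w : T} (hz : z ∈ seg x y) (hw : w ∈ seg x z) :
    w ∈ seg x y := by
  simp only [mem_seg] at *
  linarith [dist_triangle w z y, dist_triangle x w y]

theorem mem_seg_of_mem_left' {x y z w : T} (hz : z ∈ seg x y) (hw : w ∈ seg x z) :
    z ∈ seg w y := by
  simp only [mem_seg] at *
  linarith [dist_triangle w z y, dist_triangle x w y]

theorem mem_seg_of_mem_right {x y z w : T} (hz : z ∈ seg x y) (hw : w ∈ seg z y) :
    w ∈ seg x y := by
  simp only [mem_seg] at *
  linarith [dist_triangle x z w, dist_triangle x w y]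

theorem mem_seg_of_mem_right' {x y z w : T} (hz : z ∈ seg x y) (hw : w ∈ seg z y) :
    z ∈ seg x w := by
  simp only [mem_seg] at *
  linarith [dist_triangle x z w, dist_triangle x w y]

theorem eq_of_mem_seg_of_mem_seg {x y z : T} (h : z ∈ seg x y) (h' : y ∈ seg x z) : y = z := by
  simp only [mem_seg] at *
  exact dist_le_zero.1 (by linarith [dist_comm y z])

theorem smul_mem_seg {G : Type*} [Group G] [MulAction G T] [IsIsometricSMul G T] (g : G)
    {x y z : T} (h : z ∈ seg x y) : g • z ∈ seg (g • x) (g • y) := by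
  simpa only [mem_seg, dist_smul] using h

theorem smul_mem_seg_iff {G : Type*} [Group G] [MulAction G T] [IsIsometricSMul G T] (g : G)
    {x y z : T} : g • z ∈ seg (g • x) (g • y) ↔ z ∈ seg x y := by
  simp only [mem_seg, dist_smul]

end Segments

/-! ### Arcs, medians, and ℝ-trees through betweenness -/

section Arcs

variable {T : Type*} [MetricSpace T]

theorem isArc_image_Icc {x y : T} {γ : ℝ → T} {D : ℝ} (hD : 0 < D)
    (hc : ContinuousOn γ (Icc 0 D)) (hi : InjOn γ (Icc 0 D)) (h0 : γ 0 = x) (h1 : γ D = y) :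
    IsArc x y (γ '' Icc 0 D) := by
  have hm : ∀ t : unitInterval, D * (t : ℝ) ∈ Icc 0 D := fun t =>
    ⟨mul_nonneg hD.le t.2.1, mul_le_of_le_one_right hD.le t.2.2⟩
  refine ⟨⟨⟨fun t => γ (D * t), ?_⟩, by simpa using h0, by simpa using h1⟩, ?_, ?_⟩
  · exact hc.comp_continuous (by fun_prop) hm
  · intro s t hst
    have := hi (hm s) (hm t) hst
    exact Subtype.ext (mul_left_cancel₀ hD.ne' this)
  · ext z
    constructor
    · rintro ⟨t, rfl⟩
      exact ⟨_, hm t, rfl⟩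
    · rintro ⟨t, ht, rfl⟩
      refine ⟨⟨t / D, div_nonneg ht.1 hD.le, div_le_one_of_le₀ ht.2 hD.le⟩, ?_⟩
      change γ (D * (t / D)) = γ t
      rw [mul_div_cancel₀ _ hD.ne']

/-- `γ` is a unit speed geodesic on `[0, D]`. -/
def IsGeodesicOn (γ : ℝ → T) (D : ℝ) : Prop :=
  ∀ s ∈ Icc (0 : ℝ) D, ∀ t ∈ Icc (0 : ℝ) D, dist (γ s) (γ t) = |s - t|

theorem IsGeodesicOn.continuousOn {γ : ℝ → T} {D : ℝ} (h : IsGeodesicOn γ D) :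
    ContinuousOn γ (Icc 0 D) := by
  have : LipschitzOnWith 1 γ (Icc 0 D) := LipschitzOnWith.of_dist_le_mul fun s hs t ht => by
    rw [h s hs t ht, Real.dist_eq]; simp
  exact this.continuousOn

theorem IsGeodesicOn.injOn {γ : ℝ → T} {D : ℝ} (h : IsGeodesicOn γ D) :
    InjOn γ (Icc 0 D) := by
  intro s hs t ht hst
  have := h s hs t ht
  rw [hst, dist_self] at this
  linarith [abs_eq_zero.1 this.symm]

theorem IsGeodesicOn.mem_seg {γ : ℝ → T} {D : ℝ} (h : IsGeodesicOn γ D) {r s t : ℝ}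
    (hr : 0 ≤ r) (hrs : r ≤ s) (hst : s ≤ t) (ht : t ≤ D) : γ s ∈ seg (γ r) (γ t) := by
  rw [RTrees.mem_seg, h r ⟨hr, by linarith⟩ s ⟨by linarith, by linarith⟩,
    h s ⟨by linarith, by linarith⟩ t ⟨by linarith, ht⟩,
    h r ⟨hr, by linarith⟩ t ⟨by linarith, ht⟩, abs_of_nonpos, abs_of_nonpos, abs_of_nonpos]
  all_goals linarith

theorem IsGeodesicOn.dist_left {γ : ℝ → T} {D : ℝ} (h : IsGeodesicOn γ D) {t : ℝ}
    (ht : t ∈ Icc 0 D) : dist (γ 0) (γ t) = t := by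
  rw [h 0 ⟨le_rfl, ht.1.trans ht.2⟩ t ht, zero_sub, abs_neg, abs_of_nonneg ht.1]

theorem isArc_concat {x z y : T} {α β : ℝ → T} {a b : ℝ} (ha : 0 < a) (hb : 0 < b)
    (hα : IsGeodesicOn α a) (hβ : IsGeodesicOn β b) (hα0 : α 0 = x) (hαz : α a = z)
    (hβz : β 0 = z) (hβy : β b = y)
    (hαβ : ∀ s ∈ Icc 0 a, ∀ t ∈ Icc 0 b, α s = β t → s = a) :
    ∃ S, IsArc x y S ∧ z ∈ S := by
  let γ : ℝ → T := fun t => if t ≤ a then α t else β (t - a)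
  have hγα : EqOn γ α (Icc 0 a) := fun t ht => if_pos ht.2
  have hγβ : EqOn γ (fun t => β (t - a)) (Icc a (a + b)) := by
    intro t ht
    rcases ht.1.eq_or_lt with rfl | h
    · simp [γ, hαz, hβz]
    · exact if_neg (not_le.2 h)
  have hIcc : Icc 0 (a + b) = Icc 0 a ∪ Icc a (a + b) :=
    (Icc_union_Icc_eq_Icc ha.le (by linarith)).symm
  refine ⟨γ '' Icc 0 (a + b), isArc_image_Icc (by linarith) ?_ ?_ ?_ ?_, a,
    ⟨ha.le, by linarith⟩, ?_⟩
  · rw [hIcc]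
    refine ContinuousOn.union_of_isClosed ?_ ?_ isClosed_Icc isClosed_Icc
    · exact hα.continuousOn.congr hγα
    · refine ContinuousOn.congr ?_ hγβ
      exact hβ.continuousOn.comp (by fun_prop) fun t ht =>
        ⟨by linarith [ht.1], by linarith [ht.2]⟩
  · have key : ∀ s ∈ Icc 0 a, ∀ t ∈ Icc a (a + b), γ s = γ t → s = t := by
      intro s hs t ht h
      rw [hγα hs, hγβ ht] at h
      have ht' : t - a ∈ Icc 0 b := ⟨by linarith [ht.1], by linarith [ht.2]⟩
      have hsa := hαβ s hs _ ht' h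
      subst hsa
      simp only [hαz, ← hβz] at h
      have := hβ.injOn ⟨le_rfl, hb.le⟩ ht' h
      linarith
    intro s hs t ht h
    rw [hIcc] at hs ht
    rcases hs with hs | hs <;> rcases ht with ht | ht
    · rw [hγα hs, hγα ht] at h
      exact hα.injOn hs ht h
    · exact key s hs t ht h
    · exact (key t ht s hs h.symm).symm
    · rw [hγβ hs, hγβ ht] at h
      have := hβ.injOn (x₁ := s - a) ⟨by linarith [hs.1], by linarith [hs.2]⟩
        (x₂ := t - a) ⟨by linarith [ht.1], by linarith [ht.2]⟩ h
      linarith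
  · rw [hγα ⟨le_rfl, ha.le⟩, hα0]
  · rw [hγβ ⟨by linarith, le_rfl⟩]
    simpa using hβy
  · rw [hγα ⟨ha.le, le_rfl⟩, hαz]

theorem IsGeodesicOn.isArc {γ : ℝ → T} {D : ℝ} (h : IsGeodesicOn γ D) (hD : 0 < D) :
    IsArc (γ 0) (γ D) (γ '' Icc 0 D) :=
  isArc_image_Icc hD h.continuousOn h.injOn rfl rfl

namespace IsRTree

variable (hT : IsRTree T)
include hT

theorem exists_geodesic (x y : T) :
    ∃ γ : ℝ → T, γ 0 = x ∧ γ (dist x y) = y ∧ IsGeodesicOn γ (dist x y) :=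
  hT.geodesic x y

theorem eq_of_isArc {x y : T} {S S' : Set T} (h : x ≠ y) (hS : IsArc x y S) (hS' : IsArc x y S') :
    S = S' :=
  (hT.unique_arc x y h).unique hS hS'

theorem mem_seg_of_mem_isArc {x y z : T} {S : Set T} (h : x ≠ y) (hS : IsArc x y S)
    (hz : z ∈ S) : z ∈ seg x y := by
  obtain ⟨γ, h0, h1, hγ⟩ := hT.exists_geodesic x y
  have hA := hγ.isArc (dist_pos.2 h)
  rw [h0, h1] at hA
  rw [hT.eq_of_isArc h hS hA] at hz
  obtain ⟨t, ht, rfl⟩ := hz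
  simpa only [h0, h1] using hγ.mem_seg le_rfl ht.1 ht.2 le_rfl

/-- Geodesics from x to z and from z to y concatenate to an arc, which must be the image of γ by
uniqueness of arcs. Metric segments are therefore the topological arcs. -/
theorem eq_geodesic_of_mem_seg {x y z : T} {γ : ℝ → T} (h0 : γ 0 = x) (h1 : γ (dist x y) = y)
    (hγ : IsGeodesicOn γ (dist x y)) (hz : z ∈ seg x y) : γ (dist x z) = z := by
  rcases eq_or_ne x z with rfl | hxz
  · simpa using h0
  rcases eq_or_ne z y with rfl | hzy
  · exact h1
  have hz' := mem_seg.1 hz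
  have hp := dist_pos.2 hxz
  have hp' := dist_pos.2 hzy
  have hxy : x ≠ y := dist_pos.1 (by linarith)
  obtain ⟨α, hα0, hα1, hα⟩ := hT.exists_geodesic x z
  obtain ⟨β, hβ0, hβ1, hβ⟩ := hT.exists_geodesic z y
  obtain ⟨S, hS, hzS⟩ := isArc_concat hp hp' hα hβ hα0 hα1 hβ0 hβ1 (by
    intro s hs t ht hst
    have e1 := hα.dist_left hs
    have e2 := hβ t ht _ ⟨dist_nonneg, le_rfl⟩
    rw [hα0] at e1
    rw [hβ1, abs_of_nonpos (by linarith [ht.2]), ← hst] at e2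
    linarith [dist_triangle x (α s) y, hs.2, ht.1])
  have hA := hγ.isArc (dist_pos.2 hxy)
  rw [h0, h1] at hA
  rw [hT.eq_of_isArc hxy hS hA] at hzS
  obtain ⟨t, ht, rfl⟩ := hzS
  have := hγ.dist_left ht
  rw [h0] at this
  rw [this]

/-- The median is the last point at which the geodesics from x to y and from x to w coincide. Beyond
it they are disjoint, so their remainders form an arc from y to w through that point. -/
theorem exists_median (x y w : T) : ∃ m, m ∈ seg x y ∧ m ∈ seg x w ∧ m ∈ seg y w := by
  obtain ⟨α, hα0, hα1, hα⟩ := hT.exists_geodesic x y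
  obtain ⟨β, hβ0, hβ1, hβ⟩ := hT.exists_geodesic x w
  let d := min (dist x y) (dist x w)
  have hd : 0 ≤ d := le_min dist_nonneg dist_nonneg
  have hdy : d ≤ dist x y := min_le_left _ _
  have hdw : d ≤ dist x w := min_le_right _ _
  let K : Set ℝ := Icc 0 d ∩ {t | dist (α t) (β t) ∈ ({0} : Set ℝ)}
  have hK : IsClosed K := by
    have hcont : ContinuousOn (fun t => dist (α t) (β t)) (Icc 0 d) :=
      continuousOn_iff_continuous_domRestrict.2 <| Continuous.dist
        (hα.continuousOn.mono (Icc_subset_Icc_right hdy)).domRestrict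
        (hβ.continuousOn.mono (Icc_subset_Icc_right hdw)).domRestrict
    exact hcont.preimage_isClosed_of_isClosed isClosed_Icc isClosed_singleton
  have hKc : IsCompact K := isCompact_Icc.of_isClosed_subset hK inter_subset_left
  have hK0 : K.Nonempty := ⟨0, ⟨le_rfl, hd⟩, by simp [hα0, hβ0]⟩
  obtain ⟨s, ⟨hs, hsαβ⟩, hmax⟩ := hKc.exists_isGreatest hK0
  have hsαβ : α s = β s := dist_eq_zero.1 hsαβ
  have hsy : s ≤ dist x y := hs.2.trans hdy
  have hsw : s ≤ dist x w := hs.2.trans hdw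
  have m1 : α s ∈ seg x y := by
    simpa only [hα0, hα1] using hα.mem_seg le_rfl hs.1 hsy le_rfl
  have m2 : α s ∈ seg x w := by
    rw [hsαβ]
    simpa only [hβ0, hβ1] using hβ.mem_seg le_rfl hs.1 hsw le_rfl
  refine ⟨α s, m1, m2, ?_⟩
  rcases hsy.eq_or_lt with h | hlty
  · rw [h, hα1]; exact left_mem_seg _ _
  rcases hsw.eq_or_lt with h | hltw
  · rw [hsαβ, h, hβ1]; exact right_mem_seg _ _
  -- Both parameters measure the distance to x, so the geodesics can only meet at equal parameters,
  -- where the maximality of s applies.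
  have key : ∀ t ∈ Icc s (dist x y), ∀ t' ∈ Icc s (dist x w), α t = β t' → t = s ∧ t' = s := by
    intro t ht t' ht' h
    have e1 := hα.dist_left (t := t) ⟨hs.1.trans ht.1, ht.2⟩
    have e2 := hβ.dist_left (t := t') ⟨hs.1.trans ht'.1, ht'.2⟩
    rw [hα0] at e1
    rw [hβ0, ← h, e1] at e2
    subst e2
    have : t ≤ s := hmax ⟨⟨hs.1.trans ht.1, le_min ht.2 ht'.2⟩, by simp [h]⟩
    exact ⟨le_antisymm this ht.1, le_antisymm this ht.1⟩
  obtain ⟨S, hS, hm⟩ := isArc_concat (α := fun t => α (dist x y - t)) (β := fun t => β (s + t))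
    (x := y) (y := w) (z := α s) (a := dist x y - s) (b := dist x w - s)
    (by linarith) (by linarith)
    (fun p hp q hq => by
      rw [hα _ ⟨by linarith [hp.2, hs.1], by linarith [hp.1]⟩ _
        ⟨by linarith [hq.2, hs.1], by linarith [hq.1]⟩, abs_sub_comm]
      congr 1
      ring)
    (fun p hp q hq => by
      rw [hβ _ ⟨by linarith [hp.1, hs.1], by linarith [hp.2]⟩ _
        ⟨by linarith [hq.1, hs.1], by linarith [hq.2]⟩]
      congr 1
      ring)
    (by simpa using hα1) (by simp) (by simpa using hsαβ.symm) (by simpa using hβ1)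
    (by
      intro p hp q hq h
      have := (key _ ⟨by linarith [hp.2], by linarith [hp.1]⟩ _
        ⟨by linarith [hq.1], by linarith [hq.2]⟩ h).1
      linarith)
  refine hT.mem_seg_of_mem_isArc ?_ hS hm
  intro hyw
  have := (key (dist x y) ⟨hsy, le_rfl⟩ (dist x w) ⟨hsw, le_rfl⟩ (by rw [hα1, hβ1, hyw])).1
  linarith

/-- A point of `[x, y]` lies on `[x, w]` or on `[w, y]`, for every `w`. -/
theorem btw {x y p : T} (hp : p ∈ seg x y) (w : T) : p ∈ seg x w ∨ p ∈ seg w y := by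
  obtain ⟨m, hxy, hxw, hyw⟩ := hT.exists_median x y w
  obtain ⟨γ, h0, h1, hγ⟩ := hT.exists_geodesic x y
  have ep := hT.eq_geodesic_of_mem_seg h0 h1 hγ hp
  have em := hT.eq_geodesic_of_mem_seg h0 h1 hγ hxy
  have hpD : dist x p ≤ dist x y := by
    linarith [mem_seg.1 hp, dist_nonneg (x := p) (y := y)]
  have hmD : dist x m ≤ dist x y := by
    linarith [mem_seg.1 hxy, dist_nonneg (x := m) (y := y)]
  rcases le_total (dist x p) (dist x m) with h | h
  · left
    refine mem_seg_of_mem_left hxw ?_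
    have := hγ.mem_seg (r := 0) le_rfl dist_nonneg h hmD
    rwa [h0, ep, em] at this
  · right
    refine mem_seg_of_mem_right (seg_symm hyw) ?_
    have := hγ.mem_seg dist_nonneg h hpD le_rfl
    rwa [h1, ep, em] at this

theorem exists_dist_eq (x y : T) {t : ℝ} (ht : t ∈ Icc 0 (dist x y)) :
    ∃ z ∈ seg x y, dist x z = t := by
  obtain ⟨γ, h0, h1, hγ⟩ := hT.exists_geodesic x y
  refine ⟨γ t, ?_, ?_⟩
  · simpa only [h0, h1] using hγ.mem_seg le_rfl ht.1 ht.2 le_rfl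
  · simpa only [h0] using hγ.dist_left ht

end IsRTree

/-- If the path avoided m, the points w ≠ m with m on [f a, w] and those with m off [f a, w] would
disconnect it. Both sets are open by the dichotomy: moving w by less than its distance to m cannot
cross m. -/
theorem mem_image_of_mem_seg_of_btw
    (hb : ∀ x y p w : T, p ∈ seg x y → p ∈ seg x w ∨ p ∈ seg w y) {f : ℝ → T} {a b : ℝ}
    (hab : a ≤ b) (hf : ContinuousOn f (Icc a b)) {m : T} (hm : m ∈ seg (f a) (f b)) :
    ∃ t ∈ Icc a b, f t = m := by
  by_contra! hne
  have open_aux : ∀ w w' : T, dist w' w < dist m w → m ∉ seg w' w := by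
    intro w w' h h'
    linarith [mem_seg.1 h', dist_nonneg (x := w') (y := m)]
  have hU : IsOpen {w : T | w ≠ m ∧ m ∈ seg (f a) w} := by
    rw [Metric.isOpen_iff]
    rintro w ⟨hw, hmw⟩
    refine ⟨dist m w, dist_pos.2 hw.symm, fun w' hw' => ⟨?_, ?_⟩⟩
    · rintro rfl
      exact lt_irrefl _ (Metric.mem_ball.1 hw')
    · exact (hb _ _ _ w' hmw).resolve_right (open_aux w w' hw')
  have hV : IsOpen {w : T | m ∉ seg (f a) w} := by
    rw [Metric.isOpen_iff]
    intro w hw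
    have hwm : m ≠ w := by
      rintro rfl
      exact hw (right_mem_seg _ _)
    refine ⟨dist m w, dist_pos.2 hwm, fun w' hw' h => ?_⟩
    rcases hb _ _ _ w h with h1 | h1
    · exact hw h1
    · exact open_aux w w' hw' (seg_symm h1)
  have hpre : IsPreconnected (f '' Icc a b) := isPreconnected_Icc.image f hf
  obtain ⟨w, -, hwU, hwV⟩ := hpre _ _ hU hV
    (by
      rintro _ ⟨t, ht, rfl⟩
      by_cases h : m ∈ seg (f a) (f t)
      · exact Or.inl ⟨hne t ht, h⟩
      · exact Or.inr h)
    ⟨f b, ⟨b, ⟨hab, le_rfl⟩, rfl⟩, hne b ⟨hab, le_rfl⟩, hm⟩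
    ⟨f a, ⟨a, ⟨le_rfl, hab⟩, rfl⟩, fun h => by
      rw [seg_self] at h
      exact hne a ⟨le_rfl, hab⟩ h.symm⟩
  exact hwV hwU.2

/-- A nonempty metric space whose points can be interpolated by aligned ones, and which satisfies
the alignment dichotomy, is an `ℝ`-tree. -/
theorem isRTree_of_btw (hne : Nonempty T)
    (hi : ∀ x y : T, ∀ t ∈ Icc 0 (dist x y), ∃ z ∈ seg x y, dist x z = t)
    (hb : ∀ x y p w : T, p ∈ seg x y → p ∈ seg x w ∨ p ∈ seg w y) : IsRTree T := by
  have hgeo : ∀ x y : T, ∃ γ : ℝ → T, γ 0 = x ∧ γ (dist x y) = y ∧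
      IsGeodesicOn γ (dist x y) := by
    intro x y
    choose! γ hγ hγd using hi x y
    have aux : ∀ s ∈ Icc 0 (dist x y), ∀ t ∈ Icc 0 (dist x y), s ≤ t →
        dist (γ s) (γ t) = t - s := by
      intro s hs t ht hst
      have e1 := hγd s hs
      have e2 := hγd t ht
      rcases hb _ _ _ (γ t) (hγ s hs) with h | h
      · linarith [mem_seg.1 h]
      · linarith [mem_seg.1 h, mem_seg.1 (hγ s hs), mem_seg.1 (hγ t ht),
          dist_comm (γ s) (γ t), dist_nonneg (x := γ s) (y := γ t)]
    refine ⟨γ, ?_, ?_, ?_⟩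
    · exact (dist_eq_zero.1 (hγd 0 ⟨le_rfl, dist_nonneg⟩)).symm
    · have h := hγd _ (right_mem_Icc.2 (dist_nonneg (x := x) (y := y)))
      have h' := mem_seg.1 (hγ _ (right_mem_Icc.2 (dist_nonneg (x := x) (y := y))))
      exact dist_le_zero.1 (by linarith)
    · intro s hs t ht
      rcases le_total s t with h | h
      · rw [aux s hs t ht h, abs_sub_comm, abs_of_nonneg (by linarith)]
      · rw [dist_comm, aux t ht s hs h, abs_of_nonneg (by linarith)]
  have hmed : ∀ x y w : T, ∃ m, m ∈ seg x y ∧ m ∈ seg x w ∧ m ∈ seg w y := by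
    intro x y w
    have t1 := dist_triangle y x w
    have t2 := dist_triangle x y w
    have t3 := dist_triangle x w y
    -- The distance from x to the median is the Gromov product of y and w at x.
    obtain ⟨m, hm, hd⟩ := hi x y ((dist x y + dist x w - dist y w) / 2)
      ⟨by linarith [dist_comm x y], by linarith [dist_comm w y]⟩
    have hm' := mem_seg.1 hm
    rcases hb _ _ _ w hm with h | h
    · refine ⟨m, hm, h, ?_⟩
      have h' := mem_seg.1 h
      rw [mem_seg]
      linarith [dist_comm m w, dist_comm w y]
    · refine ⟨m, hm, ?_, h⟩
      have h' := mem_seg.1 h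
      rw [mem_seg]
      linarith [dist_comm m w, dist_comm w y]
  have harc : ∀ {x y : T} {S : Set T}, IsArc x y S → S = seg x y := by
    rintro x y S ⟨γ, hinj, rfl⟩
    have hext : ∀ s, ∀ hs : s ∈ Icc (0 : ℝ) 1, γ.extend s = γ ⟨s, hs⟩ := fun s hs =>
      γ.extend_apply hs
    have hcont : ∀ a b, ContinuousOn γ.extend (Icc a b) := fun a b =>
      γ.continuous_extend.continuousOn
    refine Subset.antisymm ?_ ?_
    · rintro _ ⟨⟨t, ht⟩, rfl⟩
      rw [← hext t ht]
      -- The arc visits the median of x, y and γ t both before and after time t; injectivity forces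
      -- the median to be γ t.
      obtain ⟨m, h1, h2, h3⟩ := hmed x y (γ.extend t)
      obtain ⟨s, hs, hsm⟩ := mem_image_of_mem_seg_of_btw hb ht.1 (hcont 0 t) (m := m)
        (by simpa using h2)
      obtain ⟨s', hs', hsm'⟩ := mem_image_of_mem_seg_of_btw hb ht.2 (hcont t 1) (m := m)
        (by simpa using h3)
      have hs1 : s ∈ Icc (0 : ℝ) 1 := ⟨hs.1, hs.2.trans ht.2⟩
      have hs1' : s' ∈ Icc (0 : ℝ) 1 := ⟨ht.1.trans hs'.1, hs'.2⟩
      have : s = s' := by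
        have := hinj ((hext s hs1).symm.trans ((hsm.trans hsm'.symm).trans (hext s' hs1')))
        exact congrArg Subtype.val this
      have hst : s = t := le_antisymm hs.2 (this ▸ hs'.1)
      rw [← hst, hsm]
      exact h1
    · intro m hm
      obtain ⟨t, ht, h⟩ := mem_image_of_mem_seg_of_btw hb zero_le_one (hcont 0 1) (m := m)
        (by simpa using hm)
      exact ⟨⟨t, ht⟩, by rw [← hext t ht, h]⟩
  refine ⟨hne, hgeo, fun x y hxy => ?_⟩
  obtain ⟨γ, h0, h1, hγ⟩ := hgeo x y
  have hA := hγ.isArc (dist_pos.2 hxy)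
  rw [h0, h1] at hA
  exact ⟨_, hA, fun S hS => (harc hS).trans (harc hA).symm⟩

end Arcs

/-! ### Concatenation, gates and bridges -/

section TreeGeometry

variable {T : Type*} [MetricSpace T]

namespace IsRTree

variable (hT : IsRTree T)
include hT

/-- Otherwise q would lie on [p, a], and with p on [a, q] this forces p = q. Geodesics are built
below by gluing aligned triples that overlap in a nondegenerate segment. -/
theorem concat {a p q b : T} (hp : p ∈ seg a q) (hq : q ∈ seg p b) (hpq : p ≠ q) :
    q ∈ seg a b :=
  (hT.btw hq a).resolve_left fun h => hpq (eq_of_mem_seg_of_mem_seg (seg_symm h) hp)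

theorem mem_seg_of_dist_le {x y p q : T} (hp : p ∈ seg x y) (hq : q ∈ seg x y)
    (h : dist x p ≤ dist x q) : p ∈ seg x q := by
  refine (hT.btw hp q).elim id fun h' => ?_
  simp only [mem_seg] at *
  have : dist q p = 0 := by linarith [dist_nonneg (x := q) (y := p)]
  rw [dist_eq_zero] at this
  subst this
  simp

theorem eq_of_dist_eq {x y p q : T} (hp : p ∈ seg x y) (hq : q ∈ seg x y)
    (h : dist x p = dist x q) : p = q := by
  have := mem_seg.1 (hT.mem_seg_of_dist_le hp hq h.le)
  exact dist_le_zero.1 (by linarith)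

end IsRTree

/-- `m` is the gate of `y` in `A`: it belongs to `A`, and lies between `y` and every point
of `A`. -/
def IsGate (A : Set T) (y m : T) : Prop := m ∈ A ∧ ∀ a ∈ A, m ∈ seg y a

/-- `u ∈ A` and `v ∈ B` are gates of each other: `[u, v]` is the bridge between `A` and `B`
when `u ≠ v`. -/
def IsBridge (A B : Set T) (u v : T) : Prop := IsGate A v u ∧ IsGate B u v

/-- Take the gate u in A of a point w of B, then the gate v in B of u. Since v lies between u and w,
u is still the gate of v. -/
theorem exists_isBridge {A B : Set T} (hA : ∀ y, ∃ m, IsGate A y m)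
    (hB : ∀ y, ∃ m, IsGate B y m) (hne : B.Nonempty) : ∃ u v, IsBridge A B u v := by
  obtain ⟨w, hw⟩ := hne
  obtain ⟨u, huA, hu⟩ := hA w
  obtain ⟨v, hvB, hv⟩ := hB u
  exact ⟨u, v, ⟨huA, fun a ha => mem_seg_of_mem_left' (hu a ha) (seg_symm (hv w hw))⟩, hvB, hv⟩

end TreeGeometry

/-! ### Translation lengths and axes -/

section Isometries

variable {G : Type*} [Group G] {T : Type*} [MetricSpace T] [MulAction G T]

theorem lengthFn_nonneg (g : G) : 0 ≤ lengthFn T g := Real.iInf_nonneg fun _ => dist_nonneg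

theorem lengthFn_le (g : G) (x : T) : lengthFn T g ≤ dist x (g • x) :=
  ciInf_le ⟨0, by rintro _ ⟨x, rfl⟩; exact dist_nonneg⟩ x

theorem not_isHyperbolic {g : G} : ¬ IsHyperbolic T g ↔ ∃ x : T, g • x = x := by
  simp [IsHyperbolic]

variable [IsIsometricSMul G T]

theorem dist_inv_smul (g : G) (x y : T) : dist (g⁻¹ • x) y = dist x (g • y) := by
  rw [← dist_smul g (g⁻¹ • x), smul_inv_smul]

theorem dist_smul_iterate_le (g : G) (x : T) (n : ℕ) :
    dist x (g ^ n • x) ≤ n * dist x (g • x) := by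
  induction n with
  | zero => simp
  | succ n ih =>
    have := dist_triangle x (g ^ n • x) (g ^ (n + 1) • x)
    rw [pow_succ, mul_smul, dist_smul] at this
    rw [pow_succ, mul_smul]
    push_cast
    linarith

theorem lengthFn_conj (h g : G) : lengthFn T (h * g * h⁻¹) = lengthFn T g := by
  unfold lengthFn
  rw [← (MulAction.toPerm h : Equiv.Perm T).iInf_comp (g := fun x : T =>
    dist x ((h * g * h⁻¹) • x))]
  congr 1
  ext x
  simp [mul_smul]

theorem lengthFn_inv (g : G) : lengthFn T g⁻¹ = lengthFn T g := by
  unfold lengthFn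
  congr 1
  ext x
  rw [dist_comm, dist_inv_smul]

theorem smul_mem_charSet_conj (h g : G) {x : T} :
    h • x ∈ charSet T (h * g * h⁻¹) ↔ x ∈ charSet T g := by
  simp only [charSet, mem_ofPred_eq, lengthFn_conj, mul_smul, inv_smul_smul, dist_smul]

theorem smul_mem_charSet {g : G} {x : T} (hx : x ∈ charSet T g) : g • x ∈ charSet T g := by
  simpa only [charSet, mem_ofPred_eq, dist_smul] using hx

theorem inv_smul_mem_charSet {g : G} {x : T} (hx : x ∈ charSet T g) :
    g⁻¹ • x ∈ charSet T g := by
  have : dist (g⁻¹ • x) (g • g⁻¹ • x) = dist x (g • x) := by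
    rw [dist_inv_smul, smul_inv_smul]
  simpa only [charSet, mem_ofPred_eq, this] using hx

theorem charSet_inv (g : G) : charSet T g⁻¹ = charSet T g := by
  ext x
  simp only [charSet, mem_ofPred_eq, lengthFn_inv]
  rw [dist_comm, dist_inv_smul]

theorem zpow_smul_mem_charSet {g : G} {x : T} (hx : x ∈ charSet T g) (n : ℤ) :
    g ^ n • x ∈ charSet T g := by
  have := (smul_mem_charSet_conj (T := T) (g ^ n) g (x := x)).2 hx
  rwa [((Commute.refl g).zpow_left n).eq, mul_inv_cancel_right] at this

/-- A displacement satisfying `[x, gx] ∪ [gx, g²x] = [x, g²x]` adds up along powers. -/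
theorem pow_smul_mem_seg (hT : IsRTree T) {g : G} {x : T} (h : g • x ∈ seg x (g • g • x))
    (n : ℕ) : g ^ n • x ∈ seg x (g ^ (n + 1) • x) := by
  rcases eq_or_ne (g • x) x with hfix | hne
  · have : ∀ n : ℕ, g ^ n • x = x := fun n => by
      induction n with
      | zero => simp
      | succ n ih => rw [pow_succ, mul_smul, hfix, ih]
    rw [this, this]
    exact left_mem_seg _ _
  induction n with
  | zero => simpa using left_mem_seg x _
  | succ n ih =>
    refine hT.concat ih ?_ ?_
    · have := smul_mem_seg (g ^ n) h
      rwa [← mul_smul, ← mul_smul, ← mul_smul, ← pow_succ, ← pow_succ] at this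
    · rw [pow_succ, mul_smul]
      exact fun h => hne (MulAction.injective _ h).symm

theorem dist_pow_smul (hT : IsRTree T) {g : G} {x : T} (h : g • x ∈ seg x (g • g • x))
    (n : ℕ) : dist x (g ^ n • x) = n * dist x (g • x) := by
  induction n with
  | zero => simp
  | succ n ih =>
    rw [← mem_seg.1 (pow_smul_mem_seg hT h n), ih, pow_succ, mul_smul, dist_smul]
    push_cast
    ring

/-- The distance from x to gⁿx grows exactly linearly, and passing through the orbit of y bounds it
by n d(y, gy) + 2 d(x, y). Hence no y has smaller displacement. -/
theorem lengthFn_eq_of_mem_seg (hT : IsRTree T) {g : G} {x : T}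
    (h : g • x ∈ seg x (g • g • x)) : lengthFn T g = dist x (g • x) := by
  have := hT.nonempty
  refine le_antisymm (lengthFn_le g x) (le_ciInf fun y => ?_)
  by_contra! hlt
  obtain ⟨n, hn⟩ := exists_nat_gt (2 * dist x y / (dist x (g • x) - dist y (g • y)))
  rw [div_lt_iff₀ (by linarith)] at hn
  have h1 := dist_pow_smul hT h n
  have h2 := dist_smul_iterate_le g y n
  have h3 := dist_triangle4 x y (g ^ n • y) (g ^ n • x)
  rw [dist_smul, dist_comm y x] at h3
  linarith

/-- Let m be the point where [x, gx] and [x, g⁻¹x] separate. If they share at least half their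
length, g fixes the midpoint of [x, gx]; otherwise m is aligned with its translates. -/
theorem exists_turning_point (hT : IsRTree T) (g : G) (x : T) :
    (∃ p : T, g • p = p) ∨
      ∃ m, m ∈ seg x (g • m) ∧ m ∈ seg x (g⁻¹ • m) ∧ g • m ∈ seg m (g • g • m) ∧
        dist x (g • x) = dist m (g • m) + 2 * dist x m := by
  obtain ⟨m, m1, m2, m3⟩ := hT.exists_median x (g • x) (g⁻¹ • x)
  have hxi : dist x (g⁻¹ • x) = dist x (g • x) := by rw [dist_comm, dist_inv_smul]
  have hgm : g • m ∈ seg x (g • x) := by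
    have := smul_mem_seg g m2
    rw [smul_inv_smul] at this
    exact seg_symm this
  have hdgm : dist (g • m) (g • x) = dist x m := by rw [dist_smul, dist_comm]
  have e1 := mem_seg.1 m1
  have e2 := mem_seg.1 hgm
  rcases le_or_gt (dist x (g • x)) (2 * dist x m) with h | h
  · left
    obtain ⟨p, hp, hpd⟩ := hT.exists_dist_eq x (g • x) (t := dist x (g • x) / 2)
      ⟨by positivity, by linarith [dist_nonneg (x := x) (y := g • x)]⟩
    have hpm : p ∈ seg x m := hT.mem_seg_of_dist_le hp m1 (by linarith)
    have e3 := mem_seg.1 hp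
    have hp' : g⁻¹ • p ∈ seg x (g⁻¹ • x) := by
      have := smul_mem_seg g⁻¹ hp
      rw [inv_smul_smul] at this
      exact seg_symm this
    have := hT.eq_of_dist_eq (mem_seg_of_mem_left m2 hpm) hp' (by
      rw [dist_comm x (g⁻¹ • p), dist_inv_smul]
      linarith)
    refine ⟨p, ?_⟩
    nth_rewrite 1 [this]
    simp
  · right
    have hm_gm : m ∈ seg x (g • m) := hT.mem_seg_of_dist_le m1 hgm (by linarith)
    have hgm' : g • m ∈ seg m (g • x) := mem_seg_of_mem_left' hgm hm_gm
    have h1 : g⁻¹ • m ∈ seg (g⁻¹ • x) m := by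
      have := smul_mem_seg g⁻¹ hm_gm
      rwa [inv_smul_smul] at this
    have h2 : m ∈ seg (g⁻¹ • m) x := by
      have := smul_mem_seg g⁻¹ hgm'
      rwa [inv_smul_smul, inv_smul_smul] at this
    have h3 : m ∈ seg (g⁻¹ • m) (g • m) :=
      mem_seg_of_mem_right' (mem_seg_of_mem_left' (seg_symm m3) h1) hgm'
    refine ⟨m, hm_gm, seg_symm h2, ?_, ?_⟩
    · have := smul_mem_seg g h3
      rwa [smul_inv_smul] at this
    · linarith [mem_seg.1 hm_gm]

theorem exists_smul_mem_seg (hT : IsRTree T) (g : G) : ∃ x : T, g • x ∈ seg x (g • g • x) := by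
  obtain ⟨x⟩ := hT.nonempty
  rcases exists_turning_point hT g x with ⟨p, hp⟩ | ⟨m, -, -, hm, -⟩
  · exact ⟨p, by rw [hp, hp]; exact left_mem_seg _ _⟩
  · exact ⟨m, hm⟩

theorem charSet_nonempty (hT : IsRTree T) (g : G) : (charSet T g).Nonempty := by
  obtain ⟨x, hx⟩ := exists_smul_mem_seg hT g
  exact ⟨x, (lengthFn_eq_of_mem_seg hT hx).symm⟩

theorem mem_charSet_iff (hT : IsRTree T) {g : G} {x : T} :
    x ∈ charSet T g ↔ g • x ∈ seg x (g • g • x) := by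
  refine ⟨fun h => ?_, fun h => (lengthFn_eq_of_mem_seg hT h).symm⟩
  rcases eq_or_ne (g • x) x with hfix | hne
  · rw [hfix, hfix]
    exact left_mem_seg _ _
  have hpos : 0 < dist x (g • x) := dist_pos.2 hne.symm
  -- The midpoint m of [x, gx] cannot be displaced by less than x, so the path from m to gm through
  -- gx does not backtrack.
  obtain ⟨m, hm, hmd⟩ := hT.exists_dist_eq x (g • x) (t := dist x (g • x) / 2)
    ⟨by positivity, by linarith⟩
  have e1 := mem_seg.1 hm
  have hgm := smul_mem_seg g hm
  have h1 : g • x ∈ seg m (g • m) := by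
    have l1 := lengthFn_le g m
    have l2 := dist_triangle m (g • x) (g • m)
    have l3 : dist x (g • x) = lengthFn T g := h
    rw [mem_seg]
    rw [dist_smul] at l2 ⊢
    linarith
  have h2 : g • x ∈ seg x (g • m) := hT.concat hm h1 (by
    rintro rfl
    linarith)
  exact mem_seg_of_mem_left (hT.concat h2 hgm (by
    intro h
    have := MulAction.injective _ h
    rw [← this, dist_self] at hmd
    linarith)) h2

theorem isHyperbolic_iff (hT : IsRTree T) {g : G} : IsHyperbolic T g ↔ 0 < lengthFn T g := by
  constructor
  · intro h
    obtain ⟨x, hx⟩ := charSet_nonempty hT g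
    rw [← show dist x (g • x) = _ from hx]
    exact dist_pos.2 (h x).symm
  · intro h x hx
    have := lengthFn_le g x
    rw [hx, dist_self] at this
    linarith

theorem isHyperbolic_conj (hT : IsRTree T) {g h : G} :
    IsHyperbolic T (h * g * h⁻¹) ↔ IsHyperbolic T g := by
  rw [isHyperbolic_iff hT, isHyperbolic_iff hT, lengthFn_conj]

theorem dist_pow_smul_of_mem (hT : IsRTree T) {g : G} {x : T} (hx : x ∈ charSet T g) (n : ℕ) :
    dist x (g ^ n • x) = n * lengthFn T g := by
  rw [dist_pow_smul hT ((mem_charSet_iff hT).1 hx), show dist x (g • x) = _ from hx]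

/-- In a tree, corresponding points of two segments of the same length are no further apart than
the end points. -/
theorem IsRTree.dist_le_max (hT : IsRTree T) {x y x' y' p p' : T} (hp : p ∈ seg x y)
    (h : dist x p = dist x' p') (h' : dist p y = dist p' y') :
    dist p p' ≤ max (dist x x') (dist y y') := by
  rcases hT.btw hp p' with hb | hb
  · have := mem_seg.1 hb
    exact le_max_of_le_left (by linarith [dist_triangle x x' p'])
  · have := mem_seg.1 hb
    exact le_max_of_le_right (by
      linarith [dist_triangle p' y' y, dist_comm p p', dist_comm y y'])

theorem charSet_convex (hT : IsRTree T) (g : G) : IsArcConvex (charSet T g) := by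
  intro x hx y hy p hp
  refine le_antisymm ?_ (lengthFn_le g p)
  have := hT.dist_le_max hp (dist_smul g x p).symm (dist_smul g p y).symm
  rwa [show dist x (g • x) = _ from hx, show dist y (g • y) = _ from hy, max_self] at this

/-- The hypotheses make z, m, gm, gz aligned, so z is displaced by ℓ(g) + 2 d(z, m); being on the
axis it must equal m. -/
theorem eq_of_mem_charSet_of_mem_seg (hT : IsRTree T) {g : G} (hg : IsHyperbolic T g) {z m : T}
    (hz : z ∈ charSet T g) (hm : m ∈ charSet T g) (h : m ∈ seg z (g • m))
    (h' : m ∈ seg z (g⁻¹ • m)) : z = m := by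
  have h1 : g • m ∈ seg m (g • z) := by
    have := smul_mem_seg g h'
    rw [smul_inv_smul] at this
    exact seg_symm this
  have h2 := mem_seg.1 (hT.concat h h1 (hg m).symm)
  have h3 := mem_seg.1 h
  have h4 : dist z (g • z) = _ := hz
  have h5 : dist m (g • m) = _ := hm
  rw [dist_smul, dist_comm m z] at h2
  exact dist_le_zero.1 (by linarith)

/-- The gate is the turning point m. For a on the axis, the median of y, m and a is on the axis and
sees m before both gm and g⁻¹m, so it is m. -/
theorem exists_isGate_charSet (hT : IsRTree T) {g : G} (hg : IsHyperbolic T g) (y : T) :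
    ∃ m, IsGate (charSet T g) y m ∧ dist y (g • y) = lengthFn T g + 2 * dist y m := by
  rcases exists_turning_point hT g y with ⟨p, hp⟩ | ⟨m, h1, h2, h3, h4⟩
  · exact absurd hp (hg p)
  · have hm : m ∈ charSet T g := (mem_charSet_iff hT).2 h3
    refine ⟨m, ⟨hm, fun a ha => ?_⟩, by rw [h4, show dist m (g • m) = _ from hm]⟩
    obtain ⟨q, q1, q2, q3⟩ := hT.exists_median y m a
    have := eq_of_mem_charSet_of_mem_seg hT hg (charSet_convex hT g m hm a ha q3) hm
      (mem_seg_of_mem_left' h1 q1) (mem_seg_of_mem_left' h2 q1)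
    rwa [← this]

theorem exists_isGate (hT : IsRTree T) {g : G} (hg : IsHyperbolic T g) (y : T) :
    ∃ m, IsGate (charSet T g) y m :=
  (exists_isGate_charSet hT hg y).imp fun _ h => h.1

theorem exists_isBridge_charSet (hT : IsRTree T) {p q : G} (hp : IsHyperbolic T p)
    (hq : IsHyperbolic T q) : ∃ u v, IsBridge (charSet T p) (charSet T q) u v :=
  exists_isBridge (exists_isGate hT hp) (exists_isGate hT hq) (charSet_nonempty hT q)

theorem lengthFn_mul_le {p q : G} {u v : T} (hu : u ∈ charSet T p) (hv : v ∈ charSet T q) :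
    lengthFn T (p * q) ≤ lengthFn T p + lengthFn T q + 2 * dist u v := by
  have h0 := lengthFn_le (p * q) u
  have h1 := dist_triangle u (p • u) ((p * q) • u)
  have h2 := dist_triangle4 u v (q • v) (q • u)
  rw [dist_smul, dist_comm v u] at h2
  rw [mul_smul, dist_smul] at h1
  rw [mul_smul] at h0
  rw [show dist u (p • u) = _ from hu] at h1
  rw [show dist v (q • v) = _ from hv] at h2
  linarith

/-- The points u, pu, pv, pqv, pqu, pqpu follow one another along a geodesic, because bridges leave
the axes at gates. Thus pq translates u along its own axis, and the four steps from u to pqu add up.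
-/
theorem lengthFn_mul_of_isBridge (hT : IsRTree T) {p q : G} (hp : IsHyperbolic T p)
    (hq : IsHyperbolic T q) {u v : T} (h : IsBridge (charSet T p) (charSet T q) u v)
    (huv : u ≠ v) : lengthFn T (p * q) = lengthFn T p + lengthFn T q + 2 * dist u v := by
  obtain ⟨⟨hu, hu'⟩, hv, hv'⟩ := h
  have t1 : p • u ∈ seg u (p • v) := by
    have := smul_mem_seg p (hu' _ (inv_smul_mem_charSet hu))
    rw [smul_inv_smul] at this
    exact seg_symm this
  have t2 : p • v ∈ seg (p • u) (p • q • v) := smul_mem_seg p (hv' _ (smul_mem_charSet hv))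
  have t3 : p • q • v ∈ seg (p • v) (p • q • u) := by
    have := smul_mem_seg p (smul_mem_seg q (hv' _ (inv_smul_mem_charSet hv)))
    rw [smul_inv_smul] at this
    exact seg_symm this
  have t4 : p • q • u ∈ seg (p • q • v) (p • q • p • u) :=
    smul_mem_seg p (smul_mem_seg q (hu' _ (smul_mem_charSet hu)))
  have n1 : p • u ≠ p • v := fun h => huv (MulAction.injective _ h)
  have n2 : p • v ≠ p • q • v := fun h => hq v (MulAction.injective _ h).symm
  have n3 : p • q • v ≠ p • q • u := fun h =>
    huv (MulAction.injective _ (MulAction.injective _ h)).symm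
  have s2 := hT.concat t1 t2 n1
  have s3 := hT.concat s2 t3 n2
  have s4 := hT.concat s3 t4 n3
  have n4 : p • q • u ≠ p • q • p • u := fun h =>
    hp u (MulAction.injective _ (MulAction.injective _ h)).symm
  have t5 : p • q • p • u ∈ seg (p • q • u) (p • q • p • q • u) := by
    refine smul_mem_seg p (smul_mem_seg q ?_)
    exact mem_seg_of_mem_left (mem_seg_of_mem_left s3 s2) t1
  have s5 := mem_seg_of_mem_left (hT.concat s4 t5 n4) s4
  rw [lengthFn_eq_of_mem_seg hT (g := p * q) (x := u) (by simpa only [mul_smul] using s5),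
    mul_smul, ← mem_seg.1 s3, ← mem_seg.1 s2, ← mem_seg.1 t1]
  simp only [dist_smul]
  rw [show dist u (p • u) = _ from hu, show dist v (q • v) = _ from hv, dist_comm v u]
  ring

end Isometries

/-! ### Alignment-preserving maps -/

section Alignment

variable {R T : Type*} [MetricSpace R] [MetricSpace T]

theorem eq_of_median_of_mem_seg {x y z m : T} (hz : z ∈ seg x y) (m1 : m ∈ seg x y)
    (m2 : m ∈ seg x z) (m3 : m ∈ seg y z) : m = z := by
  simp only [mem_seg] at *
  exact dist_le_zero.1 (by linarith [dist_comm y z, dist_comm y m])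

theorem PreservesAlignment.map_mem_seg {f : R → T} (hf : PreservesAlignment f) {x y z : R}
    (h : z ∈ seg x y) : f z ∈ seg (f x) (f y) := by
  rw [← hf x y]
  exact mem_image_of_mem f h

/-- Continuity is not part of the definition of a collapse map. Along a geodesic, alignment makes
the distance to the initial image monotone and onto an interval, hence continuous. -/
theorem PreservesAlignment.continuousOn_dist (hR : IsRTree R) (hT : IsRTree T) {f : R → T}
    (hf : PreservesAlignment f) {x y : R} {γ : ℝ → R} (h0 : γ 0 = x) (h1 : γ (dist x y) = y)
    (hγ : IsGeodesicOn γ (dist x y)) :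
    ContinuousOn (fun t => dist (f x) (f (γ t))) (Icc 0 (dist x y)) := by
  have hseg : ∀ t ∈ Icc 0 (dist x y), γ t ∈ seg x y := fun t ht => by
    simpa only [h0, h1] using hγ.mem_seg le_rfl ht.1 ht.2 le_rfl
  let H : Icc 0 (dist x y) → Icc 0 (dist (f x) (f y)) := fun t =>
    ⟨dist (f x) (f (γ t)), dist_nonneg, by
      have := mem_seg.1 (hf.map_mem_seg (hseg t t.2))
      linarith [dist_nonneg (x := f (γ t)) (y := f y)]⟩
  have hH : Monotone H := by
    intro s t hst
    have := hf.map_mem_seg (hγ.mem_seg le_rfl s.2.1 hst t.2.2)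
    rw [h0] at this
    have := mem_seg.1 this
    exact Subtype.mk_le_mk.2 (by linarith [dist_nonneg (x := f (γ s)) (y := f (γ t))])
  have hs : Function.Surjective H := by
    rintro ⟨r, hr⟩
    obtain ⟨z, hz, hzr⟩ := hT.exists_dist_eq (f x) (f y) hr
    rw [← hf x y] at hz
    obtain ⟨z, hz, rfl⟩ := hz
    have e := hR.eq_geodesic_of_mem_seg h0 h1 hγ hz
    refine ⟨⟨dist x z, dist_nonneg, ?_⟩, Subtype.ext ?_⟩
    · linarith [mem_seg.1 hz, dist_nonneg (x := z) (y := y)]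
    · change dist (f x) (f (γ (dist x z))) = r
      rw [e, hzr]
  have hc := continuous_subtype_val.comp (hH.continuous_of_surjective hs)
  exact continuousOn_iff_continuous_domRestrict.2 hc

end Alignment

/-! ### The standard refinement: tree, length function, minimality -/

section StandardRefinement

variable {G : Type*} [Group G] {R T₁ T₂ : Type*} [MulAction G R]
  [MetricSpace T₁] [MulAction G T₁] [MetricSpace T₂] [MulAction G T₂]
  (g₁ : R →[G] T₁) (g₂ : R →[G] T₂)

/-- The projection of `R` onto its standard refinement. -/
noncomputable def StdRefinement.mk (x : R) : StdRefinement g₁ g₂ :=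
  SeparationQuotient.mk (show SumSpace g₁ g₂ from x)

namespace StdRefinement

theorem surjective_mk : Function.Surjective (mk g₁ g₂) :=
  SeparationQuotient.surjective_mk (X := SumSpace g₁ g₂)

theorem dist_mk (x y : R) :
    dist (mk g₁ g₂ x) (mk g₁ g₂ y) = dist (g₁ x) (g₁ y) + dist (g₂ x) (g₂ y) :=
  SeparationQuotient.dist_mk (α := SumSpace g₁ g₂) x y

theorem mem_seg_mk {x y z : R} :
    mk g₁ g₂ z ∈ seg (mk g₁ g₂ x) (mk g₁ g₂ y) ↔
      g₁ z ∈ seg (g₁ x) (g₁ y) ∧ g₂ z ∈ seg (g₂ x) (g₂ y) := by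
  simp only [mem_seg, dist_mk]
  have h1 := dist_triangle (g₁ x) (g₁ z) (g₁ y)
  have h2 := dist_triangle (g₂ x) (g₂ z) (g₂ y)
  constructor
  · intro h
    constructor <;> linarith
  · rintro ⟨h, h'⟩
    linarith

variable {g₁ g₂}

theorem mk_eq_mk {x y : R} : mk g₁ g₂ x = mk g₁ g₂ y ↔ g₁ x = g₁ y ∧ g₂ x = g₂ y := by
  rw [← dist_eq_zero, dist_mk, add_eq_zero_iff_of_nonneg dist_nonneg dist_nonneg, dist_eq_zero,
    dist_eq_zero]

section Tree

variable [MetricSpace R] (hR : IsRTree R) (h₁ : PreservesAlignment g₁)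
  (h₂ : PreservesAlignment g₂)
include hR h₁ h₂

/-- Points of a segment of `T_s` lift to the corresponding segment of `R`. -/
theorem exists_mem_seg_mk_eq {x y z : R} (hz : mk g₁ g₂ z ∈ seg (mk g₁ g₂ x) (mk g₁ g₂ y)) :
    ∃ m, m ∈ seg x y ∧ m ∈ seg x z ∧ m ∈ seg y z ∧ mk g₁ g₂ m = mk g₁ g₂ z := by
  obtain ⟨m, m1, m2, m3⟩ := hR.exists_median x y z
  rw [mem_seg_mk] at hz
  refine ⟨m, m1, m2, m3, mk_eq_mk.2 ⟨?_, ?_⟩⟩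
  · exact eq_of_median_of_mem_seg hz.1 (h₁.map_mem_seg m1) (h₁.map_mem_seg m2)
      (h₁.map_mem_seg m3)
  · exact eq_of_median_of_mem_seg hz.2 (h₂.map_mem_seg m1) (h₂.map_mem_seg m2)
      (h₂.map_mem_seg m3)

/-- Interpolation is the intermediate value theorem for δ along a geodesic of R. The dichotomy
descends from R because aligned points of T_s lift to aligned points. -/
theorem isRTree (hT₁ : IsRTree T₁) (hT₂ : IsRTree T₂) : IsRTree (StdRefinement g₁ g₂) := by
  refine isRTree_of_btw (hR.nonempty.map (mk g₁ g₂)) ?_ ?_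
  · intro x y t ht
    obtain ⟨x, rfl⟩ := surjective_mk g₁ g₂ x
    obtain ⟨y, rfl⟩ := surjective_mk g₁ g₂ y
    obtain ⟨γ, e0, e1, hγ⟩ := hR.exists_geodesic x y
    have hc : ContinuousOn (fun t => dist (g₁ x) (g₁ (γ t)) + dist (g₂ x) (g₂ (γ t)))
        (Icc 0 (dist x y)) :=
      (h₁.continuousOn_dist hR hT₁ e0 e1 hγ).add
        (h₂.continuousOn_dist hR hT₂ e0 e1 hγ)
    have := intermediate_value_Icc dist_nonneg hc
    simp only [e0, e1, dist_self, add_zero] at this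
    rw [dist_mk] at ht
    obtain ⟨s, hs, rfl⟩ := this ht
    have hseg : γ s ∈ seg x y := by
      simpa only [e0, e1] using hγ.mem_seg le_rfl hs.1 hs.2 le_rfl
    exact ⟨mk g₁ g₂ (γ s), (mem_seg_mk g₁ g₂).2 ⟨h₁.map_mem_seg hseg, h₂.map_mem_seg hseg⟩,
      dist_mk _ _ _ _⟩
  · intro x y z w hz
    obtain ⟨x, rfl⟩ := surjective_mk g₁ g₂ x
    obtain ⟨y, rfl⟩ := surjective_mk g₁ g₂ y
    obtain ⟨z, rfl⟩ := surjective_mk g₁ g₂ z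
    obtain ⟨w, rfl⟩ := surjective_mk g₁ g₂ w
    obtain ⟨m, hm, -, -, hmz⟩ := exists_mem_seg_mk_eq hR h₁ h₂ hz
    rw [← hmz]
    refine (hR.btw hm w).imp ?_ ?_ <;>
      exact fun h => (mem_seg_mk g₁ g₂).2 ⟨h₁.map_mem_seg h, h₂.map_mem_seg h⟩

end Tree

variable [IsIsometricSMul G T₁] [IsIsometricSMul G T₂]

theorem fst_mk (x : R) : fst g₁ g₂ (mk g₁ g₂ x) = g₁ x := rfl

theorem snd_mk (x : R) : snd g₁ g₂ (mk g₁ g₂ x) = g₂ x := rfl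

theorem dist_eq (x y : StdRefinement g₁ g₂) : dist x y =
    dist (fst g₁ g₂ x) (fst g₁ g₂ y) + dist (snd g₁ g₂ x) (snd g₁ g₂ y) := by
  obtain ⟨x, rfl⟩ := surjective_mk g₁ g₂ x
  obtain ⟨y, rfl⟩ := surjective_mk g₁ g₂ y
  exact dist_mk _ _ _ _

theorem mem_seg_iff {x y z : StdRefinement g₁ g₂} : z ∈ seg x y ↔
    fst g₁ g₂ z ∈ seg (fst g₁ g₂ x) (fst g₁ g₂ y) ∧
      snd g₁ g₂ z ∈ seg (snd g₁ g₂ x) (snd g₁ g₂ y) := by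
  obtain ⟨x, rfl⟩ := surjective_mk g₁ g₂ x
  obtain ⟨y, rfl⟩ := surjective_mk g₁ g₂ y
  obtain ⟨z, rfl⟩ := surjective_mk g₁ g₂ z
  exact mem_seg_mk _ _

/-- A point aligned with its translates in T_s is so in both factors, so its three displacements are
the three translation lengths. -/
theorem lengthFn_eq (hT₁ : IsRTree T₁) (hT₂ : IsRTree T₂) (hS : IsRTree (StdRefinement g₁ g₂))
    (g : G) : lengthFn (StdRefinement g₁ g₂) g = lengthFn T₁ g + lengthFn T₂ g := by
  obtain ⟨x, hx⟩ := exists_smul_mem_seg hS g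
  rw [lengthFn_eq_of_mem_seg hS hx, dist_eq, map_smul, map_smul]
  rw [mem_seg_iff] at hx
  simp only [map_smul] at hx
  rw [lengthFn_eq_of_mem_seg hT₁ hx.1, lengthFn_eq_of_mem_seg hT₂ hx.2]

variable [MetricSpace R] (h₁ : PreservesAlignment g₁) (h₂ : PreservesAlignment g₂)

include h₁ h₂

theorem preservesAlignment_fst : PreservesAlignment (fst g₁ g₂) := by
  intro x y
  obtain ⟨x, rfl⟩ := surjective_mk g₁ g₂ x
  obtain ⟨y, rfl⟩ := surjective_mk g₁ g₂ y
  refine Subset.antisymm ?_ ?_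
  · rintro _ ⟨z, hz, rfl⟩
    exact (mem_seg_iff.1 hz).1
  · rw [fst_mk, fst_mk, ← h₁ x y]
    rintro _ ⟨z, hz, rfl⟩
    exact ⟨mk g₁ g₂ z, (mem_seg_mk g₁ g₂).2 ⟨h₁.map_mem_seg hz, h₂.map_mem_seg hz⟩, rfl⟩

theorem preservesAlignment_snd : PreservesAlignment (snd g₁ g₂) := by
  intro x y
  obtain ⟨x, rfl⟩ := surjective_mk g₁ g₂ x
  obtain ⟨y, rfl⟩ := surjective_mk g₁ g₂ y
  refine Subset.antisymm ?_ ?_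
  · rintro _ ⟨z, hz, rfl⟩
    exact (mem_seg_iff.1 hz).2
  · rw [snd_mk, snd_mk, ← h₂ x y]
    rintro _ ⟨z, hz, rfl⟩
    exact ⟨mk g₁ g₂ z, (mem_seg_mk g₁ g₂).2 ⟨h₁.map_mem_seg hz, h₂.map_mem_seg hz⟩, rfl⟩

end StdRefinement

theorem PreservesAlignment.image_eq_univ {G S T : Type*} [Group G] [MetricSpace S]
    [MulAction G S] [MetricSpace T] [MulAction G T] {f : S →[G] T} (hf : PreservesAlignment f)
    (hmin : IsMinimalTree G T) {A : Set S} (hne : A.Nonempty) (hA : IsArcConvex A)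
    (hinv : ∀ (g : G), ∀ x ∈ A, g • x ∈ A) : f '' A = univ := by
  refine hmin _ (hne.image f) ?_ ?_
  · rintro _ ⟨x, hx, rfl⟩ _ ⟨y, hy, rfl⟩
    rw [← hf x y]
    exact image_mono (hA x hx y hy)
  · rintro g _ ⟨x, hx, rfl⟩
    exact ⟨g • x, hinv g x hx, map_smul f g x⟩

theorem StdRefinement.isMinimalTree {G R T₁ T₂ : Type*} [Group G] [MulAction G R]
    [MetricSpace T₁] [MulAction G T₁] [MetricSpace T₂] [MulAction G T₂] {g₁ : R →[G] T₁}
    {g₂ : R →[G] T₂} [IsIsometricSMul G T₁] [IsIsometricSMul G T₂] [MetricSpace R]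
    (h₁ : PreservesAlignment g₁) (h₂ : PreservesAlignment g₂)
    (hS : IsRTree (StdRefinement g₁ g₂)) (hmin₁ : IsMinimalTree G T₁)
    (hmin₂ : IsMinimalTree G T₂) : IsMinimalTree G (StdRefinement g₁ g₂) := by
  intro A hne hA hinv
  have p₁ := preservesAlignment_fst h₁ h₂
  have p₂ := preservesAlignment_snd h₁ h₂
  refine eq_univ_of_forall fun x => ?_
  -- Choose a and b in the invariant subtree, a with the first coordinate of x and b with the
  -- second. The median of x, a, b then has both coordinates of x, so it is x, and it lies on [a,
  -- b].
  obtain ⟨a, ha, hax⟩ := (p₁.image_eq_univ hmin₁ hne hA hinv).symm ▸ mem_univ (fst g₁ g₂ x)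
  obtain ⟨b, hb, hbx⟩ := (p₂.image_eq_univ hmin₂ hne hA hinv).symm ▸ mem_univ (snd g₁ g₂ x)
  obtain ⟨m, m1, m2, m3⟩ := hS.exists_median x a b
  have : m = x := by
    rw [← dist_eq_zero, dist_eq]
    have e1 := (mem_seg_iff.1 m1).1
    have e2 := (mem_seg_iff.1 m2).2
    rw [hax, seg_self] at e1
    rw [hbx, seg_self] at e2
    rw [e1, e2, dist_self, dist_self, add_zero]
  exact this ▸ hA a ha b hb m3

end StandardRefinement

/-! ### Bridges between axes, and distances read off lengths -/

/-- At most one of `a`, `b`, `c` fails to satisfy `P`. -/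
def AtMostOneBad {ι : Type*} (P : ι → Prop) (a b c : ι) : Prop :=
  (P a ∨ P b) ∧ (P a ∨ P c) ∧ (P b ∨ P c)

/-- Two properties exclude at most two of the three candidates. With P = Q this also supplies a good
candidate for one property. -/
theorem AtMostOneBad.exists_common {ι : Type*} {P Q : ι → Prop} {a b c : ι}
    (hP : AtMostOneBad P a b c) (hQ : AtMostOneBad Q a b c) :
    ∃ i, (i = a ∨ i = b ∨ i = c) ∧ P i ∧ Q i := by
  unfold AtMostOneBad at hP hQ
  have : (P a ∧ Q a) ∨ (P b ∧ Q b) ∨ (P c ∧ Q c) := by tauto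
  rcases this with h | h | h
  · exact ⟨a, by simp, h⟩
  · exact ⟨b, by simp, h⟩
  · exact ⟨c, by simp, h⟩

section Foot

variable {G : Type*} [Group G] {T : Type*} [MetricSpace T] [MulAction G T]

/-- `g` and `k` are hyperbolic elements with disjoint axes, and `[c, v]` is the bridge between
these. -/
structure IsFoot (g k : G) (c v : T) : Prop where
  left : IsHyperbolic T g
  right : IsHyperbolic T k
  bridge : IsBridge (charSet T g) (charSet T k) c v
  ne : c ≠ v

theorem IsFoot.smul_ne {g k : G} {c v : T} (h : IsFoot g k c v) (i : ℤ) : g ^ i • c ≠ g ^ i • v :=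
  fun e => h.ne (MulAction.injective _ e)

variable [IsIsometricSMul G T]

theorem dist_zpow_smul_of_mem (hT : IsRTree T) {g : G} {x : T} (hx : x ∈ charSet T g) (n : ℤ) :
    dist x (g ^ n • x) = |(n : ℝ)| * lengthFn T g := by
  obtain ⟨n, rfl | rfl⟩ := n.eq_nat_or_neg
  · simpa using dist_pow_smul_of_mem hT hx n
  · rw [zpow_neg, dist_comm, dist_inv_smul, zpow_natCast, dist_pow_smul_of_mem hT hx n]
    simp

theorem dist_zpow_zpow_smul_of_mem (hT : IsRTree T) {g : G} {x : T} (hx : x ∈ charSet T g)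
    (m n : ℤ) : dist (g ^ m • x) (g ^ n • x) = |(n : ℝ) - m| * lengthFn T g := by
  have := dist_zpow_smul_of_mem hT hx (n - m)
  rw [← dist_smul (g ^ m), ← mul_smul, ← zpow_add] at this
  simpa using this

theorem zpow_smul_mem_seg (hT : IsRTree T) {g : G} {x : T} (hx : x ∈ charSet T g) {l m n : ℤ}
    (hlm : l ≤ m) (hmn : m ≤ n) : g ^ m • x ∈ seg (g ^ l • x) (g ^ n • x) := by
  have h1 : (l : ℝ) ≤ m := by exact_mod_cast hlm
  have h2 : (m : ℝ) ≤ n := by exact_mod_cast hmn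
  rw [mem_seg, dist_zpow_zpow_smul_of_mem hT hx, dist_zpow_zpow_smul_of_mem hT hx,
    dist_zpow_zpow_smul_of_mem hT hx, abs_of_nonneg (by linarith), abs_of_nonneg (by linarith),
    abs_of_nonneg (by linarith)]
  ring

theorem IsHyperbolic.zpow_smul_ne (hT : IsRTree T) {g : G} (hg : IsHyperbolic T g) {x : T}
    (hx : x ∈ charSet T g) {n : ℤ} (hn : n ≠ 0) : g ^ n • x ≠ x := by
  intro h
  have := dist_zpow_smul_of_mem hT hx n
  rw [h, dist_self] at this
  have h1 := (isHyperbolic_iff hT).1 hg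
  have h2 : (0 : ℝ) < |(n : ℝ)| := abs_pos.2 (by exact_mod_cast hn)
  nlinarith [mul_pos h2 h1]

namespace IsFoot

variable {g k : G} {c v : T} (h : IsFoot g k c v)
include h

theorem smul_mem_seg_smul (i : ℤ) {a : T} (ha : a ∈ charSet T g) :
    g ^ i • c ∈ seg (g ^ i • v) a := by
  have := smul_mem_seg (g ^ i) (h.bridge.1.2 _ (zpow_smul_mem_charSet ha (-i)))
  rwa [← mul_smul, ← zpow_add, add_neg_cancel, zpow_zero, one_smul] at this

theorem mem_charSet_conj (i : ℤ) : g ^ i • v ∈ charSet T (g ^ i * k * (g ^ i)⁻¹) :=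
  (smul_mem_charSet_conj _ _).2 h.bridge.2.1

/-- The points gⁱv and ygʲv lie on the axes of the two factors and are joined by the path through c
and yc, whether or not it backtracks. -/
theorem lengthFn_conj_mul_conj_le (i j : ℤ) (y : G) :
    lengthFn T ((g ^ i * k * (g ^ i)⁻¹) * (y * (g ^ j * k * (g ^ j)⁻¹) * y⁻¹)) ≤
      2 * lengthFn T k + 2 * (dist c (g ^ i • v) + dist c (y • c) + dist c (g ^ j • v)) := by
  have := lengthFn_mul_le (h.mem_charSet_conj i)
    ((smul_mem_charSet_conj y _).2 (h.mem_charSet_conj j))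
  rw [lengthFn_conj, lengthFn_conj, lengthFn_conj] at this
  have h2 := dist_triangle4 (g ^ i • v) c (y • c) (y • g ^ j • v)
  rw [dist_smul y, dist_comm _ c] at h2
  linarith

variable (hT : IsRTree T)
include hT

theorem lengthFn_mul : lengthFn T (g * k) = lengthFn T g + lengthFn T k + 2 * dist c v :=
  lengthFn_mul_of_isBridge hT h.left h.right h.bridge h.ne

theorem dist_smul_right (i : ℤ) : dist c (g ^ i • v) = |(i : ℝ)| * lengthFn T g + dist c v := by
  have h1 := mem_seg.1 (h.smul_mem_seg_smul i h.bridge.1.1)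
  rw [dist_smul, dist_comm v c] at h1
  rw [dist_comm c, ← h1, dist_comm (g ^ i • c), dist_zpow_smul_of_mem hT h.bridge.1.1]
  ring

theorem ne_smul (i : ℤ) : c ≠ g ^ i • v := by
  rw [← dist_pos, h.dist_smul_right hT]
  have := dist_pos.2 h.ne
  have := lengthFn_nonneg (T := T) g
  positivity

theorem smul_mem_seg_of_mem_conj (i : ℤ) {b : T} (hb : b ∈ charSet T (g ^ i * k * (g ^ i)⁻¹)) :
    g ^ i • v ∈ seg c b := by
  have hb' : (g ^ i)⁻¹ • b ∈ charSet T k := by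
    rw [← smul_mem_charSet_conj (g ^ i), smul_inv_smul]
    exact hb
  have := smul_mem_seg (g ^ i) (h.bridge.2.2 _ hb')
  rw [smul_inv_smul] at this
  exact hT.concat (seg_symm (h.smul_mem_seg_smul i h.bridge.1.1)) this (h.smul_ne i)

theorem mem_seg_zero {i : ℤ} (hi : i ≠ 0) : c ∈ seg (g ^ i • v) v := by
  have hc := h.bridge.1.1
  exact hT.concat (h.smul_mem_seg_smul i hc)
    (seg_symm (h.bridge.1.2 _ (zpow_smul_mem_charSet hc i))) (h.left.zpow_smul_ne hT hc hi)

theorem mem_seg_neg_one_one : c ∈ seg (g ^ (-1 : ℤ) • v) (g ^ (1 : ℤ) • v) := by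
  have hc := h.bridge.1.1
  have h0 : c ∈ seg (g ^ (-1 : ℤ) • c) (g ^ (1 : ℤ) • c) := by
    simpa only [zpow_zero, one_smul] using
      zpow_smul_mem_seg hT hc (l := -1) (m := 0) (n := 1) (by norm_num) (by norm_num)
  have h1 : c ∈ seg (g ^ (-1 : ℤ) • v) (g ^ (1 : ℤ) • c) :=
    hT.concat (h.smul_mem_seg_smul _ hc) h0 (h.left.zpow_smul_ne hT hc (by norm_num))
  have h2 := hT.concat h1 (seg_symm (h.smul_mem_seg_smul 1 hc))
    (h.left.zpow_smul_ne hT hc (by norm_num)).symm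
  exact mem_seg_of_mem_left h2 h1

/-- At most one of the translates of `v` by `g⁻¹`, `1` and `g` lies in the direction of `w`
at `c`. -/
theorem atMostOneBad (w : T) :
    AtMostOneBad (fun i : ℤ => c ∈ seg (g ^ i • v) w) (-1) 0 1 := by
  unfold AtMostOneBad
  simp only [zpow_zero, one_smul]
  refine ⟨?_, ?_, ?_⟩
  · exact (hT.btw (h.mem_seg_zero hT (by norm_num)) w).imp_right seg_symm
  · exact (hT.btw (h.mem_seg_neg_one_one hT) w).imp_right seg_symm
  · exact (hT.btw (h.mem_seg_zero hT (by norm_num)) w).symm.imp_left seg_symm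

theorem atMostOneBad_smul (y : G) (w : T) :
    AtMostOneBad (fun i : ℤ => y • c ∈ seg w (y • g ^ i • v)) (-1) 0 1 := by
  have key : ∀ i : ℤ, y • c ∈ seg w (y • g ^ i • v) ↔ c ∈ seg (g ^ i • v) (y⁻¹ • w) := fun i => by
    rw [← smul_mem_seg_iff y (x := g ^ i • v), smul_inv_smul, seg_comm]
  simp only [key]
  exact h.atMostOneBad hT _

/-- Without backtracking at c and yc, the path from gⁱv to ygʲv is a geodesic, and it is the bridge
between the axes of the two factors. -/
theorem lengthFn_conj_mul_conj {i j : ℤ} {y : G} (hi : c ∈ seg (g ^ i • v) (y • c))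
    (hj : y • c ∈ seg (g ^ i • v) (y • g ^ j • v)) :
    lengthFn T ((g ^ i * k * (g ^ i)⁻¹) * (y * (g ^ j * k * (g ^ j)⁻¹) * y⁻¹)) =
      2 * lengthFn T k + 2 * (dist c (g ^ i • v) + dist c (y • c) + dist c (g ^ j • v)) := by
  have hc : c ∈ seg (g ^ i • v) (y • g ^ j • v) := mem_seg_of_mem_left hj hi
  have hd : dist (g ^ i • v) (y • g ^ j • v) =
      dist c (g ^ i • v) + dist c (y • c) + dist c (g ^ j • v) := by
    rw [← mem_seg.1 hj, ← mem_seg.1 hi, dist_smul, dist_comm (g ^ i • v)]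
  have hne : g ^ i • v ≠ y • g ^ j • v := by
    rw [← dist_pos, hd]
    have := dist_pos.2 (h.ne_smul hT i)
    positivity
  have hB : IsBridge (charSet T (g ^ i * k * (g ^ i)⁻¹))
      (charSet T (y * (g ^ j * k * (g ^ j)⁻¹) * y⁻¹)) (g ^ i • v) (y • g ^ j • v) := by
    refine ⟨⟨h.mem_charSet_conj i, fun a ha => ?_⟩,
      (smul_mem_charSet_conj y _).2 (h.mem_charSet_conj j), fun b hb => ?_⟩
    · have h1 := seg_symm (h.smul_mem_seg_of_mem_conj hT i ha)
      exact seg_symm (mem_seg_of_mem_left (hT.concat h1 hc (h.ne_smul hT i).symm) h1)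
    · have hb' : y⁻¹ • b ∈ charSet T (g ^ j * k * (g ^ j)⁻¹) := by
        rw [← smul_mem_charSet_conj y, smul_inv_smul]
        exact hb
      have h1 := smul_mem_seg y (h.smul_mem_seg_of_mem_conj hT j hb')
      rw [smul_inv_smul] at h1
      exact hT.concat hj h1 fun e => h.ne_smul hT j (MulAction.injective _ e)
  have hk : ∀ x : G, IsHyperbolic T (x * k * x⁻¹) := fun x => (isHyperbolic_conj hT).2 h.right
  rw [lengthFn_mul_of_isBridge hT (hk _) ((isHyperbolic_conj hT).2 (hk _)) hB hne, lengthFn_conj,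
    lengthFn_conj, lengthFn_conj, hd]
  ring

end IsFoot

/-- A degenerate bridge would be a common point of the axes, and then ℓ(gk) ≤ ℓ(g) + ℓ(k). -/
theorem exists_isFoot (hT : IsRTree T) {g k : G} (hg : IsHyperbolic T g) (hk : IsHyperbolic T k)
    (h : lengthFn T g + lengthFn T k < lengthFn T (g * k)) : ∃ c v : T, IsFoot g k c v := by
  obtain ⟨c, v, hcv⟩ := exists_isBridge_charSet hT hg hk
  refine ⟨c, v, hg, hk, hcv, ?_⟩
  rintro rfl
  have := lengthFn_mul_le hcv.1.1 hcv.2.1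
  rw [dist_self] at this
  linarith

theorem exists_isFoot_of_disjoint (hT : IsRTree T) {g k : G} (hg : IsHyperbolic T g)
    (hk : IsHyperbolic T k) (h : Disjoint (charSet T g) (charSet T k)) :
    ∃ c v : T, IsFoot g k c v := by
  obtain ⟨c, v, hcv⟩ := exists_isBridge_charSet hT hg hk
  refine ⟨c, v, hg, hk, hcv, ?_⟩
  rintro rfl
  exact disjoint_left.1 h hcv.1.1 hcv.2.1

end Foot

/-! ### Additivity of distances on orbits -/

section Sum

variable {G : Type*} [Group G] {T T₁ T₂ : Type*} [MetricSpace T] [MulAction G T]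
  [IsIsometricSMul G T] [MetricSpace T₁] [MulAction G T₁] [IsIsometricSMul G T₁]
  [MetricSpace T₂] [MulAction G T₂] [IsIsometricSMul G T₂]

theorem exists_isFoot_of_lengthFn_add (hT : IsRTree T) (hT₁ : IsRTree T₁) (hT₂ : IsRTree T₂)
    (hℓ : ∀ g : G, lengthFn T g = lengthFn T₁ g + lengthFn T₂ g) {g k : G} {c₁ v₁ : T₁}
    {c₂ v₂ : T₂} (h₁ : IsFoot g k c₁ v₁) (h₂ : IsFoot g k c₂ v₂) :
    ∃ c v : T, IsFoot g k c v := by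
  have hyp : ∀ {x : G}, IsHyperbolic T₁ x → IsHyperbolic T x := fun {x} hx => by
    rw [isHyperbolic_iff hT, hℓ]
    exact add_pos_of_pos_of_nonneg ((isHyperbolic_iff hT₁).1 hx) (lengthFn_nonneg _)
  refine exists_isFoot hT (hyp h₁.left) (hyp h₁.right) ?_
  rw [hℓ, hℓ, hℓ, h₁.lengthFn_mul hT₁, h₂.lengthFn_mul hT₂]
  linarith [dist_pos.2 h₁.ne, dist_pos.2 h₂.ne]

/-- If the length function of `T` is the sum of those of `T₁` and `T₂`, so are the displacements
of the feet of bridges. -/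
theorem IsFoot.dist_eq_add (hT : IsRTree T) (hT₁ : IsRTree T₁) (hT₂ : IsRTree T₂)
    (hℓ : ∀ g : G, lengthFn T g = lengthFn T₁ g + lengthFn T₂ g) {g k : G} {c v : T}
    {c₁ v₁ : T₁} {c₂ v₂ : T₂} (h : IsFoot g k c v) (h₁ : IsFoot g k c₁ v₁)
    (h₂ : IsFoot g k c₂ v₂) (y : G) :
    dist c (y • c) = dist c₁ (y • c₁) + dist c₂ (y • c₂) := by
  have hδ : dist c v = dist c₁ v₁ + dist c₂ v₂ := by
    have := hℓ (g * k)
    rw [h.lengthFn_mul hT, h₁.lengthFn_mul hT₁, h₂.lengthFn_mul hT₂, hℓ, hℓ] at this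
    linarith
  have hd : ∀ i : ℤ, dist c (g ^ i • v) = dist c₁ (g ^ i • v₁) + dist c₂ (g ^ i • v₂) := by
    intro i
    rw [h.dist_smul_right hT, h₁.dist_smul_right hT₁, h₂.dist_smul_right hT₂, hℓ, hδ]
    ring
  have hk := hℓ k
  refine le_antisymm ?_ ?_
  -- For ≤, only the formula in T has to be an equality; the estimates in T₁ and T₂ hold for all
  -- exponents. The exponent i is chosen before j, which depends on it.
  · obtain ⟨i, -, hi, -⟩ := (h.atMostOneBad hT (y • c)).exists_common (h.atMostOneBad hT (y • c))
    obtain ⟨j, -, hj, -⟩ := (h.atMostOneBad_smul hT y (g ^ i • v)).exists_common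
      (h.atMostOneBad_smul hT y (g ^ i • v))
    have e := h.lengthFn_conj_mul_conj hT hi hj
    have e₁ := h₁.lengthFn_conj_mul_conj_le i j y
    have e₂ := h₂.lengthFn_conj_mul_conj_le i j y
    rw [hℓ, hd, hd] at e
    linarith
  -- For ≥, the same exponents must give equality in T₁ and in T₂ simultaneously.
  · obtain ⟨i, -, hi₁, hi₂⟩ := (h₁.atMostOneBad hT₁ (y • c₁)).exists_common
      (h₂.atMostOneBad hT₂ (y • c₂))
    obtain ⟨j, -, hj₁, hj₂⟩ := (h₁.atMostOneBad_smul hT₁ y (g ^ i • v₁)).exists_common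
      (h₂.atMostOneBad_smul hT₂ y (g ^ i • v₂))
    have e := h.lengthFn_conj_mul_conj_le i j y
    have e₁ := h₁.lengthFn_conj_mul_conj hT₁ hi₁ hj₁
    have e₂ := h₂.lengthFn_conj_mul_conj hT₂ hi₂ hj₂
    rw [hℓ, hd, hd] at e
    linarith

end Sum

/-! ### Medians and their additivity -/

section Medians

variable {T : Type*} [MetricSpace T]

/-- The median of three points of an `ℝ`-tree. -/
noncomputable def IsRTree.median (hT : IsRTree T) (x y z : T) : T :=
  (hT.exists_median x y z).choose

theorem IsRTree.median_mem (hT : IsRTree T) (x y z : T) :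
    hT.median x y z ∈ seg x y ∧ hT.median x y z ∈ seg x z ∧ hT.median x y z ∈ seg y z :=
  (hT.exists_median x y z).choose_spec

theorem dist_eq_of_median {x y z m : T} (h : m ∈ seg x y ∧ m ∈ seg x z ∧ m ∈ seg y z) :
    dist x m = (dist x y + dist x z - dist y z) / 2 ∧
    dist y m = (dist x y + dist y z - dist x z) / 2 ∧
    dist z m = (dist x z + dist y z - dist x y) / 2 := by
  obtain ⟨h1, h2, h3⟩ := h
  simp only [mem_seg] at *
  rw [dist_comm m y] at h1
  rw [dist_comm m z] at h2 h3
  refine ⟨?_, ?_, ?_⟩ <;> linarith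

theorem IsRTree.eq_median (hT : IsRTree T) {x y z m : T}
    (h : m ∈ seg x y ∧ m ∈ seg x z ∧ m ∈ seg y z) : m = hT.median x y z := by
  have h' := hT.median_mem x y z
  exact hT.eq_of_dist_eq h.1 h'.1 ((dist_eq_of_median h).1.trans (dist_eq_of_median h').1.symm)

theorem IsRTree.smul_median {G : Type*} [Group G] [MulAction G T] [IsIsometricSMul G T]
    (hT : IsRTree T) (g : G) (x y z : T) :
    g • hT.median x y z = hT.median (g • x) (g • y) (g • z) := by
  obtain ⟨h1, h2, h3⟩ := hT.median_mem x y z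
  exact hT.eq_median ⟨smul_mem_seg g h1, smul_mem_seg g h2, smul_mem_seg g h3⟩

theorem IsRTree.atMostOneBad_median (hT : IsRTree T) {ι : Type*} (f : ι → T) (a b c : ι) (w : T) :
    AtMostOneBad (fun i => hT.median (f a) (f b) (f c) ∈ seg w (f i)) a b c := by
  obtain ⟨h1, h2, h3⟩ := hT.median_mem (f a) (f b) (f c)
  exact ⟨(hT.btw h1 w).imp_left seg_symm, (hT.btw h2 w).imp_left seg_symm,
    (hT.btw h3 w).imp_left seg_symm⟩

variable {T₁ T₂ : Type*} [MetricSpace T₁] [MetricSpace T₂]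

/-- If distances in `T` are the sums of those in `T₁` and `T₂` for the points of a family, and for
another point `w`, this is also true of the distances from `w` to the medians of the family. -/
theorem dist_median_add (hT : IsRTree T) (hT₁ : IsRTree T₁) (hT₂ : IsRTree T₂) {ι : Type*}
    {f : ι → T} {f₁ : ι → T₁} {f₂ : ι → T₂}
    (hf : ∀ i j, dist (f i) (f j) = dist (f₁ i) (f₁ j) + dist (f₂ i) (f₂ j)) {w : T} {w₁ : T₁}
    {w₂ : T₂} (hw : ∀ i, dist w (f i) = dist w₁ (f₁ i) + dist w₂ (f₂ i)) (a b c : ι) :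
    dist w (hT.median (f a) (f b) (f c)) =
      dist w₁ (hT₁.median (f₁ a) (f₁ b) (f₁ c)) + dist w₂ (hT₂.median (f₂ a) (f₂ b) (f₂ c)) := by
  have hm : ∀ i, (i = a ∨ i = b ∨ i = c) → dist (hT.median (f a) (f b) (f c)) (f i) =
      dist (hT₁.median (f₁ a) (f₁ b) (f₁ c)) (f₁ i) +
        dist (hT₂.median (f₂ a) (f₂ b) (f₂ c)) (f₂ i) := by
    have d := dist_eq_of_median (hT.median_mem (f a) (f b) (f c))
    have d₁ := dist_eq_of_median (hT₁.median_mem (f₁ a) (f₁ b) (f₁ c))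
    have d₂ := dist_eq_of_median (hT₂.median_mem (f₂ a) (f₂ b) (f₂ c))
    rw [hf, hf, hf] at d
    intro i hi
    rw [dist_comm _ (f i), dist_comm _ (f₁ i), dist_comm _ (f₂ i)]
    rcases hi with rfl | rfl | rfl
    · linarith [d.1, d₁.1, d₂.1]
    · linarith [d.2.1, d₁.2.1, d₂.2.1]
    · linarith [d.2.2, d₁.2.2, d₂.2.2]
  refine le_antisymm ?_ ?_
  -- For some i the path from w to f i passes through the median; distances are already known to add
  -- for both the whole path and its last part.
  · obtain ⟨i, hi, h, -⟩ := (hT.atMostOneBad_median f a b c w).exists_common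
      (hT.atMostOneBad_median f a b c w)
    have e := mem_seg.1 h
    rw [hm i hi, hw] at e
    linarith [dist_triangle w₁ (hT₁.median (f₁ a) (f₁ b) (f₁ c)) (f₁ i),
      dist_triangle w₂ (hT₂.median (f₂ a) (f₂ b) (f₂ c)) (f₂ i)]
  · obtain ⟨i, hi, h₁, h₂⟩ := (hT₁.atMostOneBad_median f₁ a b c w₁).exists_common
      (hT₂.atMostOneBad_median f₂ a b c w₂)
    have e₁ := mem_seg.1 h₁
    have e₂ := mem_seg.1 h₂
    have e := dist_triangle w (hT.median (f a) (f b) (f c)) (f i)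
    rw [hm i hi, hw] at e
    linarith

/-- The median of a triple of points of a family. -/
noncomputable def IsRTree.medianOf (hT : IsRTree T) {ι : Type*} (f : ι → T) (t : ι × ι × ι) : T :=
  hT.median (f t.1) (f t.2.1) (f t.2.2)

theorem IsRTree.medianOf_diag (hT : IsRTree T) {ι : Type*} (f : ι → T) (i : ι) :
    hT.medianOf f (i, i, i) = f i := by
  have := (hT.median_mem (f i) (f i) (f i)).1
  rwa [seg_self] at this

theorem dist_medianOf_add (hT : IsRTree T) (hT₁ : IsRTree T₁) (hT₂ : IsRTree T₂) {ι : Type*}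
    {f : ι → T} {f₁ : ι → T₁} {f₂ : ι → T₂}
    (hf : ∀ i j, dist (f i) (f j) = dist (f₁ i) (f₁ j) + dist (f₂ i) (f₂ j))
    (s t : ι × ι × ι) : dist (hT.medianOf f s) (hT.medianOf f t) =
      dist (hT₁.medianOf f₁ s) (hT₁.medianOf f₁ t) +
        dist (hT₂.medianOf f₂ s) (hT₂.medianOf f₂ t) := by
  -- Additivity is applied twice: from a point of the family to a median, then from a median to a
  -- median.
  refine dist_median_add hT hT₁ hT₂ hf (fun i => ?_) _ _ _
  rw [dist_comm _ (f i), dist_comm _ (f₁ i), dist_comm _ (f₂ i)]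
  exact dist_median_add hT hT₁ hT₂ hf (hf i) _ _ _

end Medians

/-! ### Extending dominated families to collapse maps -/

section Extension

/-- The Gromov product `(x | y)_z`. -/
noncomputable def gromovProduct {T : Type*} [MetricSpace T] (x y z : T) : ℝ :=
  (dist z x + dist z y - dist x y) / 2

theorem gromovProduct_nonneg {T : Type*} [MetricSpace T] (x y z : T) :
    0 ≤ gromovProduct x y z := by
  unfold gromovProduct
  linarith [dist_triangle x z y, dist_comm x z]

theorem gromovProduct_eq_zero {T : Type*} [MetricSpace T] {x y z : T} :
    gromovProduct x y z = 0 ↔ z ∈ seg x y := by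
  rw [gromovProduct, mem_seg, dist_comm z x]
  constructor <;> intro h <;> linarith

variable {T T₁ : Type*} [MetricSpace T] [MetricSpace T₁] {J : Type*}

/-- The family `e` of points of `T₁` has Gromov products bounded by those of the family `a` of
points of `T`. -/
def IsDominated (a : J → T) (e : J → T₁) : Prop :=
  ∀ j k l, gromovProduct (e j) (e k) (e l) ≤ gromovProduct (a j) (a k) (a l)

/-- An upper estimate of the distance in `T₁` from `e x` to the image of `p`. -/
noncomputable def upperDist (a : J → T) (e : J → T₁) (x : J) (p : T) : ℝ :=
  ⨅ b : J, (dist (e x) (e b) + gromovProduct (a x) (a b) p)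

/-- The position on `[e x, e y]` of the image of a point `p` of `[a x, a y]`: a symmetric
compromise between the upper estimates from both ends. -/
noncomputable def position (a : J → T) (e : J → T₁) (x y : J) (p : T) : ℝ :=
  (dist (e x) (e y) + upperDist a e x p - upperDist a e y p) / 2

/-- `q` is the point of `[e x, e y]` corresponding to `p`. -/
def IsImagePoint (a : J → T) (e : J → T₁) (x y : J) (p : T) (q : T₁) : Prop :=
  q ∈ seg (e x) (e y) ∧ dist (e x) q = position a e x y p

variable {a : J → T} {e : J → T₁}

theorem upperDist_le (x : J) (p : T) (b : J) :
    upperDist a e x p ≤ dist (e x) (e b) + gromovProduct (a x) (a b) p :=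
  ciInf_le ⟨0, by
    rintro _ ⟨b, rfl⟩
    exact add_nonneg dist_nonneg (gromovProduct_nonneg _ _ _)⟩ b

theorem le_upperDist {x : J} {p : T} {r : ℝ}
    (h : ∀ b, r ≤ dist (e x) (e b) + gromovProduct (a x) (a b) p) : r ≤ upperDist a e x p :=
  have : Nonempty J := ⟨x⟩
  le_ciInf h

theorem upperDist_nonneg (x : J) (p : T) : 0 ≤ upperDist a e x p :=
  le_upperDist fun _ => add_nonneg dist_nonneg (gromovProduct_nonneg _ _ _)

theorem upperDist_mono {x : J} {p q : T} (h : p ∈ seg (a x) q) :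
    upperDist a e x p ≤ upperDist a e x q := by
  refine le_upperDist fun b => (upperDist_le x p b).trans ?_
  have := mem_seg.1 h
  unfold gromovProduct
  linarith [dist_triangle p q (a b), dist_comm p (a x), dist_comm q (a x)]

theorem upperDist_le_add_dist (x : J) (p q : T) :
    upperDist a e x p ≤ upperDist a e x q + dist p q := by
  rw [← sub_le_iff_le_add]
  refine le_upperDist fun b => ?_
  have := upperDist_le (a := a) (e := e) x p b
  unfold gromovProduct at *
  linarith [dist_triangle p q (a b), dist_triangle p q (a x)]

theorem continuous_upperDist (x : J) : Continuous (upperDist a e x) := by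
  have : LipschitzWith 1 (upperDist a e x) := LipschitzWith.of_dist_le_mul fun p q => by
    rw [NNReal.coe_one, one_mul, Real.dist_eq, abs_sub_le_iff]
    constructor
    · linarith [upperDist_le_add_dist (a := a) (e := e) x p q]
    · linarith [upperDist_le_add_dist (a := a) (e := e) x q p, dist_comm p q]
  exact this.continuous

theorem continuous_position (x y : J) : Continuous (position a e x y) := by
  unfold position
  have := continuous_upperDist (a := a) (e := e) x
  have := continuous_upperDist (a := a) (e := e) y
  fun_prop

theorem upperDist_le_dist {x m : J} {p : T} (h : p ∈ seg (a x) (a m)) :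
    upperDist a e x p ≤ dist (e x) (e m) := by
  have := upperDist_le (a := a) (e := e) x p m
  rwa [gromovProduct_eq_zero.2 h, add_zero] at this

theorem IsDominated.mem_seg (h : IsDominated a e) {x y z : J} (hz : a z ∈ seg (a x) (a y)) :
    e z ∈ seg (e x) (e y) :=
  gromovProduct_eq_zero.1 <| le_antisymm ((h x y z).trans_eq (gromovProduct_eq_zero.2 hz))
    (gromovProduct_nonneg _ _ _)

/-- For each b, either a m separates a x from a b, and then so does e m in T₁, or it separates a b
from p. In the second case it is the domination of Gromov products at m that shows b gives no better
estimate than m. -/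
theorem IsDominated.upperDist_eq_add (hT : IsRTree T) (h : IsDominated a e) {x m : J} {p : T}
    (hm : a m ∈ seg (a x) p) : upperDist a e x p = dist (e x) (e m) + upperDist a e m p := by
  have hmp := RTrees.mem_seg.1 hm
  refine le_antisymm ?_ ?_
  · rw [← sub_le_iff_le_add']
    refine le_upperDist fun b => ?_
    rcases hT.btw hm (a b) with hb | hb
    · have := upperDist_le (a := a) (e := e) x p b
      have hb := RTrees.mem_seg.1 hb
      unfold gromovProduct at *
      linarith [dist_triangle (e x) (e m) (e b), dist_comm p (a x), dist_comm p (a m)]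
    · have := upperDist_le (a := a) (e := e) x p m
      have hb := RTrees.mem_seg.1 hb
      unfold gromovProduct at *
      linarith [dist_comm p (a x), dist_comm p (a m), dist_comm p (a b),
        dist_comm (a m) (a b), dist_nonneg (x := e m) (y := e b)]
  · refine le_upperDist fun b => ?_
    rcases hT.btw hm (a b) with hb | hb
    · have := upperDist_le (a := a) (e := e) m p b
      have hb' := RTrees.mem_seg.1 (h.mem_seg hb)
      have hb := RTrees.mem_seg.1 hb
      unfold gromovProduct at *
      linarith [dist_comm p (a x), dist_comm p (a m)]
    · have := upperDist_le (a := a) (e := e) m p m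
      have hb := RTrees.mem_seg.1 hb
      have hd := h x b m
      unfold gromovProduct at *
      rw [dist_self, dist_self] at this
      linarith [dist_comm p (a x), dist_comm p (a m), dist_comm p (a b), dist_comm (a m) (a x),
        dist_comm (a m) (a b), dist_comm (e m) (e x), dist_triangle (e x) (e b) (e m),
        dist_comm (e m) (e b)]

theorem position_nonneg {x y : J} {p : T} (h : p ∈ seg (a x) (a y)) : 0 ≤ position a e x y p := by
  have h1 := upperDist_nonneg (a := a) (e := e) x p
  have h2 := upperDist_le_dist (e := e) (seg_symm h)
  unfold position
  linarith [dist_comm (e x) (e y)]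

theorem position_add_position (x y : J) (p : T) :
    position a e x y p + position a e y x p = dist (e x) (e y) := by
  unfold position
  linarith [dist_comm (e x) (e y)]

theorem position_le {x y : J} {p : T} (h : p ∈ seg (a x) (a y)) :
    position a e x y p ≤ dist (e x) (e y) := by
  linarith [position_add_position (a := a) (e := e) x y p, position_nonneg (e := e) (seg_symm h)]

/-- Seen from y, the upper estimate splits at m, and so does the distance from e x to e y. The two
contributions beyond m cancel, so a position does not depend on the far end of the segment. -/
theorem IsDominated.position_eq (hT : IsRTree T) (h : IsDominated a e) {x y m : J} {p : T}
    (hm : a m ∈ seg (a x) (a y)) (hp : p ∈ seg (a x) (a m)) :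
    position a e x y p = position a e x m p := by
  have h1 := h.upperDist_eq_add hT (seg_symm (mem_seg_of_mem_left' hm hp))
  have h2 := RTrees.mem_seg.1 (h.mem_seg hm)
  unfold position
  linarith [dist_comm (e y) (e m)]

theorem exists_isImagePoint (hT₁ : IsRTree T₁) {x y : J} {p : T} (h : p ∈ seg (a x) (a y)) :
    ∃ q, IsImagePoint a e x y p q :=
  hT₁.exists_dist_eq _ _ ⟨position_nonneg h, position_le h⟩

theorem IsImagePoint.symm {x y : J} {p : T} {q : T₁} (h : IsImagePoint a e x y p q) :
    IsImagePoint a e y x p q := by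
  refine ⟨seg_symm h.1, ?_⟩
  have h1 := RTrees.mem_seg.1 h.1
  have h2 := h.2
  linarith [position_add_position (a := a) (e := e) x y p, dist_comm q (e y)]

theorem IsImagePoint.eq (hT₁ : IsRTree T₁) {x y : J} {p : T} {q q' : T₁}
    (h : IsImagePoint a e x y p q) (h' : IsImagePoint a e x y p q') : q = q' :=
  hT₁.eq_of_dist_eq h.1 h'.1 (h.2.trans h'.2.symm)

/-- A set of indices such that all medians of points indexed by it belong to the family, and such
that the segments joining these points cover the tree. -/
structure IsSpanning (a : J → T) (X : Set J) : Prop where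
  exists_median : ∀ x ∈ X, ∀ y ∈ X, ∀ z ∈ X, ∃ m, a m ∈ seg (a x) (a y) ∧
    a m ∈ seg (a x) (a z) ∧ a m ∈ seg (a y) (a z)
  exists_mem_seg : ∀ p, ∃ x ∈ X, ∃ y ∈ X, p ∈ seg (a x) (a y)

variable {X : Set J}

theorem IsImagePoint.change_right (hT : IsRTree T) (hT₁ : IsRTree T₁) (h : IsDominated a e)
    (hX : IsSpanning a X) {x y z : J} (hx : x ∈ X) (hy : y ∈ X) (hz : z ∈ X) {p : T} {q : T₁}
    (hp : p ∈ seg (a x) (a y)) (hp' : p ∈ seg (a x) (a z)) (hq : IsImagePoint a e x y p q) :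
    IsImagePoint a e x z p q := by
  obtain ⟨m, m1, m2, m3⟩ := hX.exists_median x hx y hy z hz
  -- If p were beyond the median m on both branches, it would be m itself, since m lies between y
  -- and z.
  have hpm : p ∈ seg (a x) (a m) := by
    rcases hT.btw hp (a m) with h1 | h1
    · exact h1
    rcases hT.btw hp' (a m) with h2 | h2
    · exact h2
    have h4 := RTrees.mem_seg.1 (mem_seg_of_mem_left' m3 (seg_symm h1))
    have h5 := RTrees.mem_seg.1 h2
    have : dist p (a m) = 0 := by
      linarith [dist_comm p (a m), dist_nonneg (x := p) (y := a m)]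
    rw [dist_eq_zero] at this
    exact this ▸ right_mem_seg _ _
  refine ⟨?_, ?_⟩
  · refine mem_seg_of_mem_left (h.mem_seg m2) (hT₁.mem_seg_of_dist_le hq.1 (h.mem_seg m1) ?_)
    rw [hq.2, h.position_eq hT m1 hpm]
    exact position_le hpm
  · rw [hq.2, h.position_eq hT m1 hpm, h.position_eq hT m2 hpm]

/-- The end points are replaced one at a time, through whichever of [a x, a x'] and [a x', a y]
contains p. Hence the image of p is well defined. -/
theorem IsImagePoint.change (hT : IsRTree T) (hT₁ : IsRTree T₁) (h : IsDominated a e)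
    (hX : IsSpanning a X) {x y x' y' : J} (hx : x ∈ X) (hy : y ∈ X) (hx' : x' ∈ X) (hy' : y' ∈ X)
    {p : T} {q : T₁} (hp : p ∈ seg (a x) (a y)) (hp' : p ∈ seg (a x') (a y'))
    (hq : IsImagePoint a e x y p q) : IsImagePoint a e x' y' p q := by
  rcases hT.btw hp (a x') with h1 | h1
  · exact (hq.change_right hT hT₁ h hX hx hy hx' hp h1).symm.change_right hT hT₁ h hX hx' hx hy'
      (seg_symm h1) hp'
  · exact (hq.symm.change_right hT hT₁ h hX hy hx hx' (seg_symm hp) (seg_symm h1)).symm.change_right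
      hT hT₁ h hX hx' hy hy' h1 hp'

theorem exists_forall_isImagePoint (hT : IsRTree T) (hT₁ : IsRTree T₁) (h : IsDominated a e)
    (hX : IsSpanning a X) (p : T) :
    ∃ q, ∀ x ∈ X, ∀ y ∈ X, p ∈ seg (a x) (a y) → IsImagePoint a e x y p q := by
  obtain ⟨x, hx, y, hy, hp⟩ := hX.exists_mem_seg p
  obtain ⟨q, hq⟩ := exists_isImagePoint (e := e) hT₁ hp
  exact ⟨q, fun x' hx' y' hy' hp' => hq.change hT hT₁ h hX hx hy hx' hy' hp hp'⟩

theorem IsSpanning.exists_aligned (hT : IsRTree T) (hX : IsSpanning a X) {p q : T} (hpq : p ≠ q) :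
    ∃ x ∈ X, ∃ y ∈ X, p ∈ seg (a x) q ∧ q ∈ seg (a x) (a y) := by
  have aux : ∀ p q : T, ∃ x ∈ X, p ∈ seg (a x) q := by
    intro p q
    obtain ⟨x, hx, y, hy, hp⟩ := hX.exists_mem_seg p
    rcases hT.btw hp q with h | h
    · exact ⟨x, hx, h⟩
    · exact ⟨y, hy, seg_symm h⟩
  obtain ⟨x, hx, hpx⟩ := aux p q
  obtain ⟨y, hy, hqy⟩ := aux q p
  exact ⟨x, hx, y, hy, hpx, hT.concat hpx (seg_symm hqy) hpq⟩

theorem position_mono {x y : J} {p q : T} (hp : p ∈ seg (a x) q) (hq : q ∈ seg (a x) (a y)) :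
    position a e x y p ≤ position a e x y q := by
  have h1 := upperDist_mono (e := e) hp
  have h2 := upperDist_mono (e := e) (seg_symm (mem_seg_of_mem_left' hq hp))
  unfold position
  linarith

theorem dist_eq_position_sub (hT₁ : IsRTree T₁) {x y : J} {p q : T} {p' q' : T₁}
    (hp : p ∈ seg (a x) q) (hq : q ∈ seg (a x) (a y)) (hp' : IsImagePoint a e x y p p')
    (hq' : IsImagePoint a e x y q q') :
    dist p' q' = position a e x y q - position a e x y p := by
  have h := hT₁.mem_seg_of_dist_le hp'.1 hq'.1 (by
    rw [hp'.2, hq'.2]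
    exact position_mono hp hq)
  linarith [RTrees.mem_seg.1 h, hp'.2, hq'.2]

/-- Any segment [p, q] lies in order inside one with end points in X, on which f is given by the
position. The position is monotone, and continuous, so f maps [p, q] onto the segment of the images.
-/
theorem preservesAlignment_of_isImagePoint (hT : IsRTree T) (hT₁ : IsRTree T₁)
    (hX : IsSpanning a X) {f : T → T₁}
    (hf : ∀ p, ∀ x ∈ X, ∀ y ∈ X, p ∈ seg (a x) (a y) → IsImagePoint a e x y p (f p)) :
    PreservesAlignment f := by
  intro p q
  rcases eq_or_ne p q with rfl | hpq
  · simp [seg_self]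
  obtain ⟨x, hx, y, hy, h1, h2⟩ := hX.exists_aligned hT hpq
  have hpx := mem_seg_of_mem_left h2 h1
  have hmem : ∀ r ∈ seg p q, r ∈ seg (a x) q := fun r hr => mem_seg_of_mem_right h1 hr
  have hP := hf p x hx y hy hpx
  have hQ := hf q x hx y hy h2
  refine Subset.antisymm ?_ ?_
  · rintro _ ⟨r, hr, rfl⟩
    have hR := hf r x hx y hy (mem_seg_of_mem_left h2 (hmem r hr))
    rw [mem_seg, dist_eq_position_sub hT₁ (mem_seg_of_mem_right' h1 hr)
      (mem_seg_of_mem_left h2 (hmem r hr)) hP hR,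
      dist_eq_position_sub hT₁ (hmem r hr) h2 hR hQ, dist_eq_position_sub hT₁ h1 h2 hP hQ]
    ring
  · intro s hs
    have hse : s ∈ seg (e x) (e y) := by
      have : f p ∈ seg (e x) (f q) := hT₁.mem_seg_of_dist_le hP.1 hQ.1 (by
        rw [hP.2, hQ.2]
        exact position_mono h1 h2)
      exact mem_seg_of_mem_left hQ.1 (mem_seg_of_mem_right this hs)
    have hsd : dist (e x) s ∈ Icc (position a e x y p) (position a e x y q) := by
      have h3 : f p ∈ seg (e x) (f q) := hT₁.mem_seg_of_dist_le hP.1 hQ.1 (by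
        rw [hP.2, hQ.2]
        exact position_mono h1 h2)
      have e1 := mem_seg.1 (mem_seg_of_mem_right' h3 hs)
      have e2 := mem_seg.1 (mem_seg_of_mem_right h3 hs)
      rw [← hP.2, ← hQ.2]
      constructor
      · linarith [dist_nonneg (x := f p) (y := s)]
      · linarith [dist_nonneg (x := s) (y := f q)]
    obtain ⟨γ, g0, g1, hγ⟩ := hT.exists_geodesic p q
    have hc : ContinuousOn (fun t => position a e x y (γ t)) (Icc 0 (dist p q)) :=
      (continuous_position x y).comp_continuousOn hγ.continuousOn
    have := intermediate_value_Icc dist_nonneg hc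
    simp only [g0, g1] at this
    obtain ⟨t, ht, hts⟩ := this hsd
    have hr : γ t ∈ seg p q := by
      simpa only [g0, g1] using hγ.mem_seg le_rfl ht.1 ht.2 le_rfl
    have hR := hf (γ t) x hx y hy (mem_seg_of_mem_left h2 (hmem _ hr))
    exact ⟨γ t, hr, hT₁.eq_of_dist_eq hR.1 hse (hR.2.trans hts)⟩

theorem position_of_isometric {x y : J} {p : T} (hp : p ∈ seg (a x) (a y))
    (h : ∀ j k, dist (e j) (e k) = dist (a j) (a k)) : position a e x y p = dist (a x) p := by
  have key : ∀ x y : J, p ∈ seg (a x) (a y) → upperDist a e x p = dist (a x) p := by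
    intro x y hp
    refine le_antisymm ?_ ?_
    -- For an isometric family the infimum is attained at b = x.
    · have := upperDist_le (a := a) (e := e) x p x
      unfold gromovProduct at this
      rw [dist_self, dist_self] at this
      linarith [dist_comm p (a x)]
    · refine le_upperDist fun b => ?_
      rw [h]
      unfold gromovProduct
      linarith [dist_triangle (a x) (a b) p, dist_comm p (a x), dist_comm p (a b)]
  have e1 := key x y hp
  have e2 := key y x (seg_symm hp)
  have := mem_seg.1 hp
  unfold position
  rw [e1, e2, h]
  linarith [dist_comm p (a y)]

theorem isometry_of_isImagePoint (hT : IsRTree T) (hT₁ : IsRTree T₁)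
    (hX : IsSpanning a X) {f : T → T₁}
    (hf : ∀ p, ∀ x ∈ X, ∀ y ∈ X, p ∈ seg (a x) (a y) → IsImagePoint a e x y p (f p))
    (h : ∀ j k, dist (e j) (e k) = dist (a j) (a k)) : Isometry f := by
  refine Isometry.of_dist_eq fun p q => ?_
  rcases eq_or_ne p q with rfl | hpq
  · simp
  obtain ⟨x, hx, y, hy, h1, h2⟩ := hX.exists_aligned hT hpq
  have hpx := mem_seg_of_mem_left h2 h1
  rw [dist_eq_position_sub hT₁ h1 h2 (hf p x hx y hy hpx) (hf q x hx y hy h2),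
    position_of_isometric hpx h, position_of_isometric h2 h]
  linarith [mem_seg.1 h1]

variable {G : Type*} [Group G] [MulAction G T] [IsIsometricSMul G T] [MulAction G T₁]
  [IsIsometricSMul G T₁] [MulAction G J]

theorem upperDist_smul (ha : ∀ (g : G) j, a (g • j) = g • a j)
    (he : ∀ (g : G) j, e (g • j) = g • e j) (g : G) (x : J) (p : T) :
    upperDist a e (g • x) (g • p) = upperDist a e x p := by
  unfold upperDist
  rw [← (MulAction.toPerm g : Equiv.Perm J).iInf_comp]
  simp [gromovProduct, ha, he]

theorem IsImagePoint.smul (ha : ∀ (g : G) j, a (g • j) = g • a j)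
    (he : ∀ (g : G) j, e (g • j) = g • e j) (g : G) {x y : J} {p : T} {q : T₁}
    (h : IsImagePoint a e x y p q) : IsImagePoint a e (g • x) (g • y) (g • p) (g • q) := by
  refine ⟨?_, ?_⟩
  · rw [he, he]
    exact smul_mem_seg g h.1
  · rw [he, dist_smul, h.2]
    unfold position
    rw [upperDist_smul ha he, upperDist_smul ha he, he, he, dist_smul]

/-- A dominated equivariant family extends to an equivariant alignment preserving map. -/
theorem IsDominated.exists_extension (hT : IsRTree T) (hT₁ : IsRTree T₁) (h : IsDominated a e)
    (hX : IsSpanning a X) (hXG : ∀ (g : G), ∀ x ∈ X, g • x ∈ X)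
    (ha : ∀ (g : G) j, a (g • j) = g • a j) (he : ∀ (g : G) j, e (g • j) = g • e j) :
    ∃ f : T →[G] T₁, PreservesAlignment f ∧
      ((∀ j k, dist (e j) (e k) = dist (a j) (a k)) → Isometry f) := by
  choose f hf using exists_forall_isImagePoint hT hT₁ h hX
  refine ⟨⟨f, fun g p => ?_⟩, preservesAlignment_of_isImagePoint hT hT₁ hX hf,
    isometry_of_isImagePoint hT hT₁ hX hf⟩
  obtain ⟨x, hx, y, hy, hp⟩ := hX.exists_mem_seg p
  refine IsImagePoint.eq hT₁ (hf (g • p) (g • x) (hXG g x hx) (g • y) (hXG g y hy) ?_)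
    ((hf p x hx y hy hp).smul ha he g)
  rw [ha, ha]
  exact smul_mem_seg g hp

end Extension

/-! ### Collapse maps from the hull of an orbit -/

section OrbitExtension

variable {G : Type*} [Group G] {T T₁ T₂ : Type*} [MetricSpace T] [MulAction G T]
  [IsIsometricSMul G T] [MetricSpace T₁] [MulAction G T₁] [IsIsometricSMul G T₁]
  [MetricSpace T₂] [MulAction G T₂] [IsIsometricSMul G T₂]

variable (G) in
/-- The union of the segments joining points of the orbit of `c`. -/
def orbitHull (c : T) : Set T := {p | ∃ x y : G, p ∈ seg (x • c) (y • c)}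

omit [IsIsometricSMul G T] in
theorem self_mem_orbitHull (c : T) : c ∈ orbitHull G c :=
  ⟨1, 1, by simp [seg_self]⟩

theorem smul_mem_orbitHull (c : T) (g : G) {p : T} (hp : p ∈ orbitHull G c) :
    g • p ∈ orbitHull G c := by
  obtain ⟨x, y, h⟩ := hp
  exact ⟨g * x, g * y, by simpa only [mul_smul] using smul_mem_seg g h⟩

omit [IsIsometricSMul G T] in
theorem isArcConvex_orbitHull (hT : IsRTree T) (c : T) : IsArcConvex (orbitHull G c) := by
  rintro p ⟨x, y, hp⟩ q ⟨x', y', hq⟩ r hr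
  rcases hT.btw hr (x • c) with h | h
  · exact ⟨x, y, mem_seg_of_mem_left hp (seg_symm h)⟩
  rcases hT.btw h (x' • c) with h' | h'
  · exact ⟨x, x', h'⟩
  · exact ⟨x', y', mem_seg_of_mem_left hq h'⟩

omit [IsIsometricSMul G T₂] in
/-- If `T` is the hull of an orbit whose distances are the sums of those of orbits of `T₁` and
`T₂`, it has an equivariant alignment preserving map to `T₁`. -/
theorem exists_map_of_dist_add (hT : IsRTree T) (hT₁ : IsRTree T₁) (hT₂ : IsRTree T₂) {c : T}
    {c₁ : T₁} {c₂ : T₂} (hc : orbitHull G c = univ)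
    (hd : ∀ x y : G, dist (x • c) (y • c) =
      dist (x • c₁) (y • c₁) + dist (x • c₂) (y • c₂)) :
    ∃ f : T →[G] T₁, PreservesAlignment f ∧ (Subsingleton T₂ → Isometry f) := by
  have hadd := dist_medianOf_add hT hT₁ hT₂ hd
  -- The family is indexed by triples so as to contain the medians of orbit points. Diagonal triples
  -- give the orbit itself, and only their medians are required, so the family need not be closed
  -- under medians.
  have key := IsDominated.exists_extension (G := G) (J := G × G × G)
    (a := hT.medianOf fun x : G => x • c) (e := hT₁.medianOf fun x : G => x • c₁)
    (X := range fun x : G => (x, x, x)) hT hT₁ ?_ ?_ ?_ ?_ ?_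
  · obtain ⟨f, hf, hf'⟩ := key
    refine ⟨f, hf, fun _ => hf' fun j k => ?_⟩
    rw [hadd, Subsingleton.elim (hT₂.medianOf (fun x : G => x • c₂) j)
      (hT₂.medianOf (fun x : G => x • c₂) k), dist_self, add_zero]
  · intro j k l
    have := gromovProduct_nonneg (hT₂.medianOf (fun x : G => x • c₂) j)
      (hT₂.medianOf (fun x : G => x • c₂) k) (hT₂.medianOf (fun x : G => x • c₂) l)
    unfold gromovProduct at *
    rw [hadd, hadd, hadd]
    linarith
  · constructor
    · rintro _ ⟨x, rfl⟩ _ ⟨y, rfl⟩ _ ⟨z, rfl⟩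
      refine ⟨(x, y, z), ?_⟩
      simp only [IsRTree.medianOf_diag]
      exact hT.median_mem _ _ _
    · intro p
      obtain ⟨x, y, h⟩ : p ∈ orbitHull G c := hc ▸ mem_univ p
      refine ⟨_, ⟨x, rfl⟩, _, ⟨y, rfl⟩, ?_⟩
      simpa only [IsRTree.medianOf_diag] using h
  · rintro g _ ⟨x, rfl⟩
    exact ⟨g * x, rfl⟩
  · intro g j
    simp only [IsRTree.medianOf, hT.smul_median, Prod.smul_fst, Prod.smul_snd, smul_assoc]
  · intro g j
    simp only [IsRTree.medianOf, hT₁.smul_median, Prod.smul_fst, Prod.smul_snd, smul_assoc]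

end OrbitExtension

/-! ### A common hyperbolic element -/

section CommonHyperbolic

variable {G : Type*} [Group G] {T : Type*} [MetricSpace T] [MulAction G T]
  [IsIsometricSMul G T]

theorem isHyperbolic_of_mem_seg (hT : IsRTree T) {g : G} {x : T} (hne : g • x ≠ x)
    (h : g • x ∈ seg x (g • g • x)) : IsHyperbolic T g := by
  rw [isHyperbolic_iff hT, lengthFn_eq_of_mem_seg hT h]
  exact dist_pos.2 hne.symm

theorem isHyperbolic_inv (hT : IsRTree T) {g : G} :
    IsHyperbolic T g⁻¹ ↔ IsHyperbolic T g := by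
  rw [isHyperbolic_iff hT, isHyperbolic_iff hT, lengthFn_inv]

theorem IsHyperbolic.pow_smul_ne (hT : IsRTree T) {g : G} (hg : IsHyperbolic T g) {x : T}
    (hx : x ∈ charSet T g) {n : ℕ} (hn : n ≠ 0) : g ^ n • x ≠ x := by
  have := hg.zpow_smul_ne hT hx (n := n) (by exact_mod_cast hn)
  rwa [zpow_natCast] at this

/-- As r turns the forward half-axis away from the backward one, p⁻ⁿx, x and rpⁿx are aligned.
Applying pⁿ aligns x with its first two translates by pⁿr. -/
theorem isHyperbolic_pow_mul_of_fixed (hT : IsRTree T) {p r : G} (hp : IsHyperbolic T p) {x : T}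
    (hx : x ∈ charSet T p) (hr : r • x = x) (h : x ∈ seg (p⁻¹ • x) (r • p • x)) {n : ℕ}
    (hn : n ≠ 0) : IsHyperbolic T (p ^ n * r) := by
  have hp1 : p⁻¹ • x ≠ x := by simpa using hp.zpow_smul_ne hT hx (n := -1) (by norm_num)
  have h1 : x ∈ seg ((p ^ n)⁻¹ • x) (r • p • x) := by
    have := zpow_smul_mem_seg hT hx (l := -n) (m := -1) (n := 0) (by lia) (by lia)
    simp only [zpow_neg, zpow_natCast, zpow_one, zpow_zero, one_smul] at this
    exact hT.concat this h hp1
  have h2 : r • p • x ∈ seg x (r • p ^ n • x) := by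
    have := zpow_smul_mem_seg hT hx (l := 0) (m := 1) (n := n) (by lia) (by lia)
    simp only [zpow_natCast, zpow_one, zpow_zero, one_smul] at this
    have := smul_mem_seg r this
    rwa [hr] at this
  have hne : x ≠ r • p • x := by
    intro e
    rw [← hr] at e
    nth_rewrite 2 [hr] at e
    exact hp x (MulAction.injective r e).symm
  have h3 := mem_seg_of_mem_left (hT.concat h1 h2 hne) h1
  have h4 := smul_mem_seg (p ^ n) h3
  rw [smul_inv_smul] at h4
  refine isHyperbolic_of_mem_seg hT (x := x) ?_ ?_
  · rw [mul_smul, hr]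
    exact hp.pow_smul_ne hT hx hn
  · simp only [mul_smul, hr]
    exact h4

/-- As with disjoint axes, the points x, pⁿx, pⁿz, pⁿqx, pⁿqpⁿx follow one another along a geodesic,
since q makes no backtrack at its fixed point z. -/
theorem isHyperbolic_pow_mul_of_mem_seg (hT : IsRTree T) {p q : G} (hp : IsHyperbolic T p)
    {x z : T} (hxz : IsGate (charSet T p) z x) (hqz : q • z = z) (hne : z ≠ x)
    (hz : z ∈ seg x (q • x)) {n : ℕ} (hn : n ≠ 0) : IsHyperbolic T (p ^ n * q) := by
  obtain ⟨hx, hgate⟩ := hxz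
  have hmem : ∀ m : ℤ, p ^ m • x ∈ charSet T p := zpow_smul_mem_charSet hx
  have t1 : p ^ n • x ∈ seg x (p ^ n • z) := by
    have := smul_mem_seg (p ^ n) (hgate _ (hmem (-n)))
    rw [zpow_neg, zpow_natCast, smul_inv_smul] at this
    exact seg_symm this
  have t2 := smul_mem_seg (p ^ n) hz
  have t3 : p ^ n • q • x ∈ seg (p ^ n • z) (p ^ n • q • p ^ n • x) := by
    have := smul_mem_seg (p ^ n) (smul_mem_seg q (hgate _ (hmem n)))
    rwa [hqz, zpow_natCast] at this
  have hfix := hp.pow_smul_ne hT hx hn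
  have s1 := hT.concat t1 t2 fun e => hne (MulAction.injective _ e).symm
  have s2 := hT.concat s1 t3 fun e => hne (by
    have := MulAction.injective _ e
    nth_rewrite 1 [← hqz] at this
    exact MulAction.injective _ this)
  have t4 : p ^ n • q • p ^ n • x ∈ seg (p ^ n • q • x) (p ^ n • q • p ^ n • q • x) :=
    smul_mem_seg (p ^ n) (smul_mem_seg q (mem_seg_of_mem_left s1 t1))
  have s3 := hT.concat s2 t4 fun e =>
    hfix (MulAction.injective _ (MulAction.injective _ e)).symm
  refine isHyperbolic_of_mem_seg hT (x := x) ?_ ?_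
  · rw [mul_smul]
    intro e
    rw [e, seg_self] at s1
    rw [s1, seg_self] at t1
    exact hfix t1
  · simpa only [mul_smul] using mem_seg_of_mem_left s3 s2

/-- If `p` is hyperbolic and `q` is elliptic, all products `pⁿ q` or all products `pⁿ q²` are
hyperbolic. -/
theorem exists_forall_isHyperbolic_pow_mul_pow (hT : IsRTree T) {p q : G}
    (hp : IsHyperbolic T p) (hq : ¬ IsHyperbolic T q) :
    ∃ m : ℕ, m ≠ 0 ∧ ∀ n : ℕ, n ≠ 0 → IsHyperbolic T (p ^ n * q ^ m) := by
  obtain ⟨y, hy⟩ := not_isHyperbolic.1 hq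
  obtain ⟨x, hx, hgate⟩ := exists_isGate hT hp y
  -- The last common point z of [y, x] and [y, qx] is fixed by q. Off the axis of p it gives m = 1;
  -- otherwise it is the gate x.
  obtain ⟨z, z1, z2, z3⟩ := hT.exists_median y x (q • x)
  have hqz : q • z = z := by
    have := smul_mem_seg q z1
    rw [hy] at this
    refine hT.eq_of_dist_eq this z2 ?_
    conv_lhs => rw [← hy, dist_smul]
  rcases ne_or_eq z x with hne | rfl
  · refine ⟨1, one_ne_zero, fun n hn => ?_⟩
    rw [pow_one]
    exact isHyperbolic_pow_mul_of_mem_seg hT hp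
      ⟨hx, fun a ha => mem_seg_of_mem_left' (hgate a ha) z1⟩ hqz hne z3 hn
  · have h0 : z ∈ seg (p⁻¹ • z) (p • z) := by
      simpa using zpow_smul_mem_seg hT hx (l := -1) (m := 0) (n := 1) (by lia) (by lia)
    have hq2 : q ^ 2 • z = z := by rw [pow_two, mul_smul, hqz, hqz]
    have hm1 : z ∈ seg (p⁻¹ • z) (q • p • z) → ∃ m : ℕ, m ≠ 0 ∧ ∀ n : ℕ, n ≠ 0 →
        IsHyperbolic T (p ^ n * q ^ m) := fun h => ⟨1, one_ne_zero, fun n hn => by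
      rw [pow_one]
      exact isHyperbolic_pow_mul_of_fixed hT hp hx hqz h hn⟩
    -- If qpz lies in the direction of p⁻¹z, then q moves the direction of pz, so q²pz and qpz are
    -- in different directions at z and the exponent 2 works.
    rcases hT.btw h0 (q • p • z) with h1 | h1
    · exact hm1 h1
    have h2 := smul_mem_seg q h1
    rw [hqz] at h2
    rcases hT.btw h2 (p⁻¹ • z) with h3 | h3
    · refine ⟨2, two_ne_zero, fun n hn => ?_⟩
      refine isHyperbolic_pow_mul_of_fixed hT hp hx hq2 ?_ hn
      rw [pow_two, mul_smul]
      exact seg_symm h3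
    · exact hm1 h3

variable {T' : Type*} [MetricSpace T'] [MulAction G T'] [IsIsometricSMul G T']

/-- Two actions with hyperbolic elements have a common hyperbolic element. -/
theorem exists_common_isHyperbolic (hT : IsRTree T) (hT' : IsRTree T') {a b : G}
    (ha : IsHyperbolic T a) (hb : IsHyperbolic T' b) :
    ∃ g : G, IsHyperbolic T g ∧ IsHyperbolic T' g := by
  by_cases ha' : IsHyperbolic T' a
  · exact ⟨a, ha, ha'⟩
  by_cases hb' : IsHyperbolic T b
  · exact ⟨b, hb', hb⟩
  -- Each tree dictates the exponent of its own elliptic element and allows any nonzero exponent on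
  -- the other, so both requirements are met by one product, up to conjugation.
  obtain ⟨m, hm, h⟩ := exists_forall_isHyperbolic_pow_mul_pow hT ha hb'
  obtain ⟨n, hn, h'⟩ := exists_forall_isHyperbolic_pow_mul_pow hT' hb ha'
  refine ⟨a ^ n * b ^ m, h n hn, ?_⟩
  rw [← isHyperbolic_conj hT' (h := b ^ m)]
  simpa [mul_assoc] using h' m hm

end CommonHyperbolic

/-! ### Ends of axes and disjoint axes -/

section Ends

variable {G : Type*} [Group G] {T : Type*} [MetricSpace T] [MulAction G T]

/-- `x` maps the ray `(bⁿ o)` to a ray asymptotic to `(aⁿ o)`. -/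
def MapsRay (a b : G) (o : T) (x : G) : Prop :=
  ∃ C : ℝ, ∀ n : ℕ, dist (a ^ n • o) (x • b ^ n • o) ≤ C

variable [IsIsometricSMul G T]

theorem MapsRay.inv_mul {a b : G} {o : T} {x y : G} (hx : MapsRay a b o x)
    (hy : MapsRay a b o y) : MapsRay b b o (y⁻¹ * x) := by
  obtain ⟨C, hC⟩ := hx
  obtain ⟨D, hD⟩ := hy
  refine ⟨D + C, fun n => ?_⟩
  rw [mul_smul, dist_comm, dist_inv_smul, dist_comm]
  exact (dist_triangle_left _ _ (a ^ n • o)).trans (add_le_add (hD n) (hC n))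

/-- The stabilizer of the end of the ray `(aⁿ o)`. -/
def rayStabilizer (a : G) (o : T) : Subgroup G where
  carrier := {x | MapsRay a a o x}
  one_mem' := ⟨0, by simp⟩
  mul_mem' := by
    rintro x y ⟨C, hC⟩ ⟨D, hD⟩
    refine ⟨C + D, fun n => (dist_triangle _ (x • a ^ n • o) _).trans (add_le_add (hC n) ?_)⟩
    rw [mul_smul, dist_smul]
    exact hD n
  inv_mem' := by
    rintro x ⟨C, hC⟩
    refine ⟨C, fun n => ?_⟩
    rw [dist_comm, dist_inv_smul]
    exact hC n

/-- Each S i lies in a left coset of H i, so this is B. H. Neumann's lemma: finitely many cosets of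
subgroups of infinite index do not cover a group. -/
theorem exists_notMem_of_not_finiteIndex {ι : Type*} [Finite ι] (S : ι → Set G)
    (H : ι → Subgroup G) (hS : ∀ i, ∀ x ∈ S i, ∀ y ∈ S i, y⁻¹ * x ∈ H i)
    (hH : ∀ i, ¬ (H i).FiniteIndex) : ∃ x, ∀ i, x ∉ S i := by
  have := Fintype.ofFinite ι
  by_contra! hcov
  have hr : ∀ i, ∃ r : G, ∀ x ∈ S i, r⁻¹ * x ∈ H i := by
    intro i
    rcases (S i).eq_empty_or_nonempty with h | ⟨y, hy⟩
    · exact ⟨1, by simp [h]⟩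
    · exact ⟨y, fun x hx => hS i x hx y hy⟩
  choose r hr using hr
  obtain ⟨k, -, hk⟩ := Subgroup.exists_finiteIndex_of_leftCoset_cover (H := H) (g := r)
    (s := Finset.univ) (by
      refine eq_univ_of_forall fun x => ?_
      obtain ⟨i, hi⟩ := hcov x
      refine mem_iUnion₂.2 ⟨i, Finset.mem_univ i, ?_⟩
      rw [mem_leftCoset_iff]
      exact hr i x hi)
  exact hH k hk

theorem charSet_pow (hT : IsRTree T) {g : G} (hg : IsHyperbolic T g) {n : ℕ} (hn : n ≠ 0) :
    charSet T (g ^ n) = charSet T g := by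
  have hsub : charSet T g ⊆ charSet T (g ^ n) := by
    intro x hx
    rw [mem_charSet_iff hT]
    have := zpow_smul_mem_seg hT hx (l := 0) (m := n) (n := n + n) (by lia) (by lia)
    rw [zpow_add, mul_smul] at this
    simpa using this
  have hgn : IsHyperbolic T (g ^ n) := by
    obtain ⟨x, hx⟩ := charSet_nonempty hT g
    exact isHyperbolic_of_mem_seg hT (hg.pow_smul_ne hT hx hn)
      ((mem_charSet_iff hT).1 (hsub hx))
  refine Subset.antisymm (fun y hy => ?_) hsub
  obtain ⟨u, hu, hgate⟩ := exists_isGate hT hg y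
  have := eq_of_mem_charSet_of_mem_seg hT hgn hy (hsub hu)
    (hgate _ (by simpa using zpow_smul_mem_charSet hu n))
    (hgate _ (by simpa using zpow_smul_mem_charSet hu (-n)))
  rwa [this]

/-- Bounded displacement by h keeps the ray within C/2 of the axis of h. A segment whose ends are
that close to the axis lies in it except within C/2 of its ends. -/
theorem exists_forall_mem_charSet (hT : IsRTree T) {a h : G} (ha : IsHyperbolic T a)
    (hh : IsHyperbolic T h) {o : T} (ho : o ∈ charSet T a) (hm : h ∈ rayStabilizer a o) :
    ∃ N : ℕ, ∀ n, N ≤ n → a ^ n • o ∈ charSet T h := by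
  obtain ⟨C, hC⟩ := hm
  have hℓ := (isHyperbolic_iff hT).1 ha
  choose π hπ hπd using fun n : ℕ => exists_isGate_charSet hT hh (a ^ n • o)
  have hR : ∀ n, dist (a ^ n • o) (π n) ≤ C / 2 := fun n => by
    linarith [hC n, hπd n, lengthFn_nonneg (T := T) h]
  have hdist : ∀ m k : ℕ, dist (a ^ m • o) (a ^ (m + k) • o) = k * lengthFn T a := fun m k => by
    rw [pow_add, mul_smul, dist_smul, dist_pow_smul_of_mem hT ho]
  obtain ⟨N, hN⟩ := exists_nat_gt (C / 2 / lengthFn T a)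
  rw [div_lt_iff₀ hℓ] at hN
  refine ⟨N, fun n hn => ?_⟩
  have hseg : a ^ n • o ∈ seg (a ^ 0 • o) (a ^ (n + N) • o) := by
    have := zpow_smul_mem_seg hT ho (l := 0) (m := n) (n := (n + N : ℕ)) (by lia) (by lia)
    simpa only [zpow_natCast, zpow_zero, pow_zero] using this
  have h0 : C / 2 < dist (a ^ 0 • o) (a ^ n • o) := by
    have := hdist 0 n
    rw [zero_add] at this
    rw [this]
    have : (N : ℝ) ≤ n := by exact_mod_cast hn
    nlinarith
  have h1 : C / 2 < dist (a ^ n • o) (a ^ (n + N) • o) := by rwa [hdist]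
  have h2 := (hT.btw hseg (π 0)).resolve_left fun h => by
    linarith [mem_seg.1 h, hR 0, dist_nonneg (x := a ^ n • o) (y := π 0)]
  have h3 := (hT.btw h2 (π (n + N))).resolve_right fun h => by
    linarith [mem_seg.1 h, hR (n + N), dist_nonneg (x := π (n + N)) (y := a ^ n • o),
      dist_comm (π (n + N)) (a ^ (n + N) • o)]
  exact charSet_convex hT h _ (hπ 0).1 _ (hπ (n + N)).1 h3

/-- If the index were finite, powers of both elements of an irreducible pair would fix the end.
Their axes would then share a terminal part of the ray, contradicting compactness. -/
theorem not_finiteIndex_rayStabilizer (hT : IsRTree T) (hirr : IsIrreducibleTree G T) {a : G}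
    (ha : IsHyperbolic T a) {o : T} (ho : o ∈ charSet T a) :
    ¬ (rayStabilizer a o).FiniteIndex := by
  intro hfin
  obtain ⟨p, q, hp, hq, hK⟩ := hirr
  have key : ∀ p : G, IsHyperbolic T p → ∃ N : ℕ, ∀ n, N ≤ n → a ^ n • o ∈ charSet T p := by
    intro p hp
    obtain ⟨m, hm, -, hpm⟩ := Subgroup.exists_pow_mem_of_index_ne_zero hfin.index_ne_zero p
    have e := charSet_pow hT hp hm.ne'
    obtain ⟨x, hx⟩ := charSet_nonempty hT p
    have hpmh : IsHyperbolic T (p ^ m) := isHyperbolic_of_mem_seg hT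
      (hp.pow_smul_ne hT hx hm.ne') ((mem_charSet_iff hT).1 (e ▸ hx))
    exact e ▸ exists_forall_mem_charSet hT ha hpmh ho hpm
  obtain ⟨N, hN⟩ := key p hp
  obtain ⟨M, hM⟩ := key q hq
  obtain ⟨D, hD⟩ := Metric.isBounded_iff.1 hK.isBounded
  have hℓ := (isHyperbolic_iff hT).1 ha
  obtain ⟨k, hk⟩ := exists_nat_gt (D / lengthFn T a)
  rw [div_lt_iff₀ hℓ] at hk
  have hmem : ∀ k : ℕ, a ^ (N + M + k) • o ∈ charSet T p ∩ charSet T q := fun k =>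
    ⟨hN _ (by lia), hM _ (by lia)⟩
  have := hD (hmem 0) (hmem k)
  rw [add_zero, pow_add a (N + M), mul_smul, dist_smul, dist_pow_smul_of_mem hT ho] at this
  linarith

theorem charSet_trichotomy (hT : IsRTree T) {g : G} (hg : IsHyperbolic T g) {y z : T}
    (hy : y ∈ charSet T g) (hz : z ∈ charSet T g) :
    y ∈ seg z (g • y) ∨ g • y ∈ seg z y ∨ z ∈ seg y (g • y) := by
  obtain ⟨m, m1, m2, m3⟩ := hT.exists_median z y (g • y)
  rcases eq_or_ne m y with rfl | hmy
  · exact Or.inl m2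
  rcases eq_or_ne m (g • y) with rfl | hmgy
  · exact Or.inr (Or.inl m1)
  refine Or.inr (Or.inr ?_)
  have hm := charSet_convex hT g y hy _ (smul_mem_charSet hy) m3
  have hy0 : y ∈ seg (g⁻¹ • y) (g • y) := by
    have := smul_mem_seg g⁻¹ ((mem_charSet_iff hT).1 hy)
    simpa using this
  have h1 : y ∈ seg (g⁻¹ • m) m := by
    have hi : g⁻¹ • m ∈ seg (g⁻¹ • y) y := by
      have := smul_mem_seg g⁻¹ m3
      rwa [inv_smul_smul] at this
    exact mem_seg_of_mem_right' (mem_seg_of_mem_left' hy0 hi) m3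
  have h2 : g • y ∈ seg m (g • m) := by
    have := smul_mem_seg g h1
    rwa [smul_inv_smul] at this
  have e1 := hT.concat m1 (seg_symm h1) hmy
  have e2 := hT.concat m2 h2 hmgy
  have := eq_of_mem_charSet_of_mem_seg hT hg hz hm (mem_seg_of_mem_left e2 m2)
    (mem_seg_of_mem_left e1 m1)
  rwa [this]

theorem exists_zpow_dist_le (hT : IsRTree T) {g : G} (hg : IsHyperbolic T g) {y z : T}
    (hy : y ∈ charSet T g) (hz : z ∈ charSet T g) :
    ∃ n : ℤ, dist z (g ^ n • y) ≤ lengthFn T g := by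
  have hℓ := (isHyperbolic_iff hT).1 hg
  obtain ⟨k, hk⟩ := exists_nat_gt (dist z y / lengthFn T g)
  rw [div_lt_iff₀ hℓ] at hk
  replace hk := hk.le
  induction k generalizing y with
  | zero => exact ⟨0, by simpa using hk.trans (by simpa using hℓ.le)⟩
  | succ k ih =>
    -- Translating y by g or g⁻¹, whichever points towards z, shortens the distance to z by ℓ(g),
    -- unless z lies on the segment [y, g'y] already.
    have step : ∀ (g' : G), IsHyperbolic T g' → lengthFn T g' = lengthFn T g →
        charSet T g' = charSet T g → (∃ s : ℤ, g' = g ^ s) → ¬ y ∈ seg z (g' • y) →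
        ∃ n : ℤ, dist z (g ^ n • y) ≤ lengthFn T g := by
      rintro g' hg' hl hA ⟨s, rfl⟩ hnot
      have hyd : dist y (g ^ s • y) = lengthFn T g := by
        rw [← hl]
        exact (hA.symm ▸ hy : y ∈ charSet T (g ^ s))
      rcases charSet_trichotomy hT hg' (hA ▸ hy) (hA ▸ hz) with h | h | h
      · exact absurd h hnot
      · have := mem_seg.1 h
        push_cast at hk
        obtain ⟨n, hn⟩ := ih (y := g ^ s • y) (zpow_smul_mem_charSet hy s) (by
          linarith [dist_comm y (g ^ s • y)])
        exact ⟨n + s, by rwa [zpow_add, mul_smul]⟩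
      · have := mem_seg.1 h
        exact ⟨0, by
          rw [zpow_zero, one_smul, dist_comm]
          linarith [dist_nonneg (x := z) (y := g ^ s • y)]⟩
    by_cases h1 : y ∈ seg z (g • y)
    · by_cases h2 : y ∈ seg z (g⁻¹ • y)
      · rw [eq_of_mem_charSet_of_mem_seg hT hg hz hy h1 h2]
        exact ⟨0, by simpa using hℓ.le⟩
      · exact step g⁻¹ ((isHyperbolic_inv hT).2 hg) (lengthFn_inv g) (charSet_inv g)
          ⟨-1, by simp⟩ h2
    · exact step g hg rfl rfl ⟨1, by simp⟩ h1

/-- Comparing distances to o bounds the gap between i and j, so the rays are close at equal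
parameters i that are arbitrarily large. In a tree they are then uniformly close at all earlier
parameters. -/
theorem mapsRay_of_frequently (hT : IsRTree T) {a b x : G} {o : T} (hoa : o ∈ charSet T a)
    (hob : o ∈ charSet T b) (hab : lengthFn T a = lengthFn T b) {C : ℝ}
    (h : ∀ N : ℕ, ∃ i j : ℕ, N ≤ i ∧ dist (a ^ i • o) (x • b ^ j • o) ≤ C) :
    MapsRay a b o x := by
  refine ⟨max (dist o (x • o)) (2 * C + dist o (x • o)), fun n => ?_⟩
  obtain ⟨i, j, hni, hd⟩ := h n
  have hℓ := lengthFn_nonneg (T := T) b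
  have hij : dist (b ^ j • o) (b ^ i • o) ≤ C + dist o (x • o) := by
    have h1 := dist_zpow_zpow_smul_of_mem hT hob j i
    simp only [zpow_natCast, Int.cast_natCast] at h1
    rw [h1, ← abs_of_nonneg hℓ, ← abs_mul, abs_le]
    have ei := dist_pow_smul_of_mem hT hoa i
    have ej := dist_pow_smul_of_mem hT hob j
    rw [hab] at ei
    have t1 := dist_triangle4 o (x • o) (x • b ^ j • o) (a ^ i • o)
    rw [dist_smul] at t1
    have t2 := dist_triangle (x • o) o (x • b ^ j • o)
    have t3 := dist_triangle o (a ^ i • o) (x • b ^ j • o)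
    rw [dist_smul] at t2
    constructor
    · linarith [dist_comm (x • o) o]
    · linarith [dist_comm (x • b ^ j • o) (a ^ i • o)]
  have hii : dist (a ^ i • o) (x • b ^ i • o) ≤ 2 * C + dist o (x • o) := by
    have := dist_triangle (a ^ i • o) (x • b ^ j • o) (x • b ^ i • o)
    rw [dist_smul] at this
    linarith
  have hsa : a ^ n • o ∈ seg o (a ^ i • o) := by
    simpa using zpow_smul_mem_seg hT hoa (l := 0) (m := n) (n := i) (by lia) (by lia)
  have hsb : b ^ n • o ∈ seg o (b ^ i • o) := by
    simpa using zpow_smul_mem_seg hT hob (l := 0) (m := n) (n := i) (by lia) (by lia)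
  have e0 : dist o (a ^ n • o) = dist o (b ^ n • o) := by
    rw [dist_pow_smul_of_mem hT hoa, dist_pow_smul_of_mem hT hob, hab]
  have e1 : dist o (a ^ i • o) = dist o (b ^ i • o) := by
    rw [dist_pow_smul_of_mem hT hoa, dist_pow_smul_of_mem hT hob, hab]
  refine (hT.dist_le_max hsa (x' := x • o) (y' := x • b ^ i • o) ?_ ?_).trans
    (max_le_max le_rfl hii)
  · rw [dist_smul, e0]
  · rw [dist_smul]
    linarith [mem_seg.1 hsa, mem_seg.1 hsb]

/-- `g` or its inverse. -/
def signed (g : G) (s : Bool) : G := cond s g g⁻¹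

theorem charSet_signed (g : G) (s : Bool) : charSet T (signed g s) = charSet T g := by
  cases s
  · exact charSet_inv g
  · rfl

theorem lengthFn_signed (g : G) (s : Bool) : lengthFn T (signed g s) = lengthFn T g := by
  cases s
  · exact lengthFn_inv g
  · rfl

theorem isHyperbolic_signed (hT : IsRTree T) {g : G} (hg : IsHyperbolic T g) (s : Bool) :
    IsHyperbolic T (signed g s) := by
  rwa [isHyperbolic_iff hT, lengthFn_signed, ← isHyperbolic_iff hT]

theorem exists_signed_pow_eq (g : G) (n : ℤ) : ∃ s, g ^ n = signed g s ^ n.natAbs := by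
  obtain ⟨k, rfl | rfl⟩ := n.eq_nat_or_neg
  · exact ⟨true, by simp [signed]⟩
  · exact ⟨false, by simp [signed]⟩

/-- If `x` maps no end of the axis of `g` to an end of that axis, the axes of `g` and `x g x⁻¹`
have bounded intersection. -/
theorem exists_dist_le_of_not_mapsRay (hT : IsRTree T) {g x : G} (hg : IsHyperbolic T g) {o : T}
    (ho : o ∈ charSet T g) (hx : ∀ s t, ¬ MapsRay (signed g s) (signed g t) o x) :
    ∃ D : ℝ, ∀ z ∈ charSet T g, z ∈ charSet T (x * g * x⁻¹) → dist o z ≤ D := by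
  have hℓ := (isHyperbolic_iff hT).1 hg
  -- The constant 2ℓ(g) allows for a point common to both axes being within ℓ(g) of an orbit point
  -- on each of them.
  have hb : ∀ st : Bool × Bool, ∃ N : ℕ, ∀ i j : ℕ, N ≤ i →
      2 * lengthFn T g < dist (signed g st.1 ^ i • o) (x • signed g st.2 ^ j • o) := by
    intro st
    by_contra! h
    exact hx st.1 st.2 (mapsRay_of_frequently hT (by rwa [charSet_signed])
      (by rwa [charSet_signed]) (by rw [lengthFn_signed, lengthFn_signed]) h)
  choose N hN using hb
  obtain ⟨M, hM⟩ := (finite_range N).bddAbove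
  refine ⟨(M + 1) * lengthFn T g, fun z hz hz' => ?_⟩
  by_contra! hlt
  obtain ⟨n, hn⟩ := exists_zpow_dist_le hT hg ho hz
  have hz'' : x⁻¹ • z ∈ charSet T g := by
    rw [← smul_mem_charSet_conj x, smul_inv_smul]
    exact hz'
  obtain ⟨m, hm⟩ := exists_zpow_dist_le hT hg ho hz''
  rw [dist_inv_smul] at hm
  have hdo := dist_zpow_smul_of_mem hT ho n
  have hMn : (M : ℝ) < |(n : ℝ)| := by
    have := dist_triangle o (g ^ n • o) z
    rw [hdo] at this
    by_contra! hle
    nlinarith [dist_comm (g ^ n • o) z]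
  obtain ⟨s, hs⟩ := exists_signed_pow_eq g n
  obtain ⟨t, ht⟩ := exists_signed_pow_eq g m
  have h1 := hN (s, t) n.natAbs m.natAbs ((hM (mem_range_self _)).trans (by
    rw [← Int.cast_abs, Int.abs_eq_natAbs] at hMn
    exact_mod_cast hMn.le))
  simp only [← hs, ← ht] at h1
  linarith [dist_triangle_left (g ^ n • o) (x • g ^ m • o) z]

/-- If the axes of `g` and `h` have bounded intersection, large powers of `h` move the axis of `g`
away from itself. -/
theorem disjoint_charSet_conj_pow (hT : IsRTree T) {g h : G} (hh : IsHyperbolic T h) {o : T}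
    {D : ℝ} (hD : ∀ z ∈ charSet T g, z ∈ charSet T h → dist o z ≤ D) {n : ℕ}
    (hn : 2 * D < n * lengthFn T h) (hn0 : 0 < n * lengthFn T h) :
    Disjoint (charSet T g) (charSet T (h ^ n * g * (h ^ n)⁻¹)) := by
  rw [disjoint_left]
  intro z hz hz'
  have hz0 : (h ^ n)⁻¹ • z ∈ charSet T g := by
    rw [← smul_mem_charSet_conj (h ^ n), smul_inv_smul]
    exact hz'
  -- The geodesic from h⁻ⁿz to z runs along the axis of h from m to hⁿm. Its ends are on the axis of
  -- g, so both axes contain m and hⁿm, which are more than 2D apart.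
  obtain ⟨m, hm, hgate⟩ := exists_isGate hT hh ((h ^ n)⁻¹ • z)
  have hmem : ∀ k : ℤ, h ^ k • m ∈ charSet T h := zpow_smul_mem_charSet hm
  have hd := dist_pow_smul_of_mem hT hm n
  have h1 : m ∈ seg ((h ^ n)⁻¹ • z) (h ^ n • m) :=
    hgate _ (by simpa using hmem n)
  have h2 : h ^ n • m ∈ seg m z := by
    have := smul_mem_seg (h ^ n) (hgate _ (hmem (-n)))
    rw [smul_inv_smul, zpow_neg, zpow_natCast, smul_inv_smul] at this
    exact seg_symm this
  have hne : m ≠ h ^ n • m := by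
    rw [← dist_pos, hd]
    linarith
  have h3 := hT.concat h1 h2 hne
  have c1 := charSet_convex hT g _ hz0 _ hz h3
  have c2 := charSet_convex hT g _ hz0 _ hz (mem_seg_of_mem_left h3 h1)
  have d1 := hD _ c1 (by simpa using hmem n)
  have d2 := hD _ c2 hm
  linarith [dist_triangle_left m (h ^ n • m) o]

end Ends

/-! ### Common bridges, orbits and the theorem -/

section Main

variable {G : Type*} [Group G] {T₁ T₂ : Type*} [MetricSpace T₁] [MulAction G T₁]
  [IsIsometricSMul G T₁] [MetricSpace T₂] [MulAction G T₂] [IsIsometricSMul G T₂]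

/-- Two irreducible actions have a common pair of hyperbolic elements with disjoint axes. -/
theorem exists_common_isFoot (hT₁ : IsRTree T₁) (hT₂ : IsRTree T₂)
    (h₁ : IsIrreducibleTree G T₁) (h₂ : IsIrreducibleTree G T₂) :
    ∃ (g k : G) (c₁ v₁ : T₁) (c₂ v₂ : T₂), IsFoot g k c₁ v₁ ∧ IsFoot g k c₂ v₂ := by
  obtain ⟨a, -, ha, -⟩ := id h₁
  obtain ⟨b, -, hb, -⟩ := id h₂
  obtain ⟨g, hg₁, hg₂⟩ := exists_common_isHyperbolic hT₁ hT₂ ha hb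
  obtain ⟨o₁, ho₁⟩ := charSet_nonempty hT₁ g
  obtain ⟨o₂, ho₂⟩ := charSet_nonempty hT₂ g
  -- In each tree, x must avoid four sets, one for each pair of ends of the axis of g; two elements
  -- of one set differ by an element of an end stabilizer, of infinite index.
  obtain ⟨x, hx⟩ := exists_notMem_of_not_finiteIndex (ι := (Bool × Bool) ⊕ (Bool × Bool))
    (Sum.elim (fun i => {x | MapsRay (signed g i.1) (signed g i.2) o₁ x})
      (fun i => {x | MapsRay (signed g i.1) (signed g i.2) o₂ x}))
    (Sum.elim (fun i => rayStabilizer (signed g i.2) o₁)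
      (fun i => rayStabilizer (signed g i.2) o₂))
    (by
      rintro (i | i) x hx y hy
      · exact MapsRay.inv_mul hx hy
      · exact MapsRay.inv_mul hx hy)
    (by
      rintro (i | i)
      · exact not_finiteIndex_rayStabilizer hT₁ h₁ (isHyperbolic_signed hT₁ hg₁ _)
          (by rwa [charSet_signed])
      · exact not_finiteIndex_rayStabilizer hT₂ h₂ (isHyperbolic_signed hT₂ hg₂ _)
          (by rwa [charSet_signed]))
  obtain ⟨D₁, hD₁⟩ := exists_dist_le_of_not_mapsRay hT₁ (x := x) hg₁ ho₁ fun s t =>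
    hx (Sum.inl (s, t))
  obtain ⟨D₂, hD₂⟩ := exists_dist_le_of_not_mapsRay hT₂ (x := x) hg₂ ho₂ fun s t =>
    hx (Sum.inr (s, t))
  have hl₁ := (isHyperbolic_iff hT₁).1 hg₁
  have hl₂ := (isHyperbolic_iff hT₂).1 hg₂
  -- The second element is k = hⁿgh⁻ⁿ with h = xgx⁻¹, and n is large enough for both trees.
  obtain ⟨n, hn⟩ := exists_nat_gt
    (max 0 (max (2 * D₁ / lengthFn T₁ g) (2 * D₂ / lengthFn T₂ g)))
  rw [max_lt_iff, max_lt_iff, div_lt_iff₀ hl₁, div_lt_iff₀ hl₂] at hn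
  obtain ⟨hn0, hn₁, hn₂⟩ := hn
  have d₁ := disjoint_charSet_conj_pow hT₁ ((isHyperbolic_conj hT₁).2 hg₁) hD₁ (n := n)
    (by rwa [lengthFn_conj]) (by rw [lengthFn_conj]; positivity)
  have d₂ := disjoint_charSet_conj_pow hT₂ ((isHyperbolic_conj hT₂).2 hg₂) hD₂ (n := n)
    (by rwa [lengthFn_conj]) (by rw [lengthFn_conj]; positivity)
  obtain ⟨c₁, v₁, f₁⟩ := exists_isFoot_of_disjoint hT₁ hg₁ ((isHyperbolic_conj hT₁).2 hg₁) d₁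
  obtain ⟨c₂, v₂, f₂⟩ := exists_isFoot_of_disjoint hT₂ hg₂ ((isHyperbolic_conj hT₂).2 hg₂) d₂
  exact ⟨_, _, c₁, v₁, c₂, v₂, f₁, f₂⟩

theorem dist_smul_smul_add {T : Type*} [MetricSpace T] [MulAction G T] [IsIsometricSMul G T]
    {c : T} {c₁ : T₁} {c₂ : T₂}
    (h : ∀ y : G, dist c (y • c) = dist c₁ (y • c₁) + dist c₂ (y • c₂)) (x y : G) :
    dist (x • c) (y • c) = dist (x • c₁) (y • c₁) + dist (x • c₂) (y • c₂) := by
  have := h (x⁻¹ * y)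
  simp only [mul_smul] at this
  rwa [dist_comm c, dist_comm c₁, dist_comm c₂, dist_inv_smul, dist_inv_smul, dist_inv_smul,
    dist_comm _ (x • c), dist_comm _ (x • c₁), dist_comm _ (x • c₂)] at this

/-- The base points of `T₁` and `T₂` are chosen independently of the tree `T` with length function
`ℓ₁ + ℓ₂`. -/
theorem exists_base_points (hT₁ : IsRTree T₁) (hT₂ : IsRTree T₂) (h₁ : IsIrreducibleTree G T₁)
    (h₂ : IsIrreducibleTree G T₂) : ∃ (c₁ : T₁) (c₂ : T₂), ∀ (T : Type*) [MetricSpace T]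
    [MulAction G T] [IsIsometricSMul G T], IsRTree T →
    (∀ g : G, lengthFn T g = lengthFn T₁ g + lengthFn T₂ g) → ∃ c : T, ∀ x y : G,
      dist (x • c) (y • c) = dist (x • c₁) (y • c₁) + dist (x • c₂) (y • c₂) := by
  obtain ⟨g, k, c₁, v₁, c₂, v₂, f₁, f₂⟩ := exists_common_isFoot hT₁ hT₂ h₁ h₂
  refine ⟨c₁, c₂, fun T _ _ _ hT hℓ => ?_⟩
  obtain ⟨c, v, f⟩ := exists_isFoot_of_lengthFn_add hT hT₁ hT₂ hℓ f₁ f₂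
  exact ⟨c, dist_smul_smul_add (f.dist_eq_add hT hT₁ hT₂ hℓ f₁ f₂)⟩

theorem IsArcConvex.isRTree {T : Type*} [MetricSpace T] (hT : IsRTree T) {S : Set T}
    (hS : IsArcConvex S) (hne : S.Nonempty) : IsRTree S := by
  have hseg : ∀ x y z : S, z ∈ seg x y ↔ (z : T) ∈ seg (x : T) y := fun _ _ _ => Iff.rfl
  refine isRTree_of_btw hne.to_subtype ?_ ?_
  · intro x y t ht
    obtain ⟨z, hz, hd⟩ := hT.exists_dist_eq (x : T) y ht
    exact ⟨⟨z, hS x x.2 y y.2 hz⟩, hz, hd⟩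
  · intro x y p w hp
    simpa only [hseg] using hT.btw ((hseg _ _ _).1 hp) w

theorem isRTree_punit : IsRTree PUnit :=
  isRTree_of_btw inferInstance
    (fun x y t ht => ⟨x, left_mem_seg x y, by
      rw [Subsingleton.elim x y, dist_self] at *
      exact le_antisymm ht.1 ht.2⟩)
    fun x y p w _ => Or.inl (Subsingleton.elim x p ▸ left_mem_seg x w)

/-- Minimal trees with isometric orbits are equivariantly isometric. -/
theorem exists_isometryEquiv_of_orbit {T T' : Type*} [MetricSpace T] [MulAction G T]
    [IsIsometricSMul G T] [MetricSpace T'] [MulAction G T'] [IsIsometricSMul G T']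
    (hT : IsRTree T) (hT' : IsRTree T') (hmin : IsMinimalTree G T) (hmin' : IsMinimalTree G T')
    {c : T} {c' : T'} (h : ∀ x y : G, dist (x • c) (y • c) = dist (x • c') (y • c')) :
    ∃ e : T ≃ᵢ T', ∀ (g : G) (x : T), e (g • x) = g • e x := by
  -- With a one-point second tree, additivity says that the orbits of c and c' are isometric.
  obtain ⟨f, hf, hiso⟩ := exists_map_of_dist_add (T₂ := PUnit.{1}) (c₂ := PUnit.unit) hT hT'
    isRTree_punit
    (hmin _ ⟨c, self_mem_orbitHull c⟩ (isArcConvex_orbitHull hT c)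
      fun g _ => smul_mem_orbitHull c g) (fun x y => by simpa using h x y)
  have hsurj : Function.Surjective f := by
    have := hf.image_eq_univ hmin' (A := univ) ⟨c, mem_univ c⟩ (fun _ _ _ _ => subset_univ _)
      fun _ _ _ => mem_univ _
    rwa [image_univ, range_eq_univ] at this
  have hi := hiso inferInstance
  exact ⟨⟨Equiv.ofBijective f ⟨hi.injective, hsurj⟩, hi⟩, fun g x => map_smul f g x⟩

/-- The action on an invariant subset. -/
abbrev subMulActionOfInvariant {T : Type*} [MulAction G T] (S : Set T)
    (h : ∀ (g : G), ∀ x ∈ S, g • x ∈ S) : SubMulAction G T where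
  carrier := S
  smul_mem' g _ hx := h g _ hx

end Main

/-- The tree T may be too large to map to T₁ and T₂, since it need not be minimal; the hull of the
orbit of c serves as common refinement instead. -/
theorem compatible_of_lengthFn_add {G : Type*} [Group G] {T T₁ T₂ : Type u} [MetricSpace T]
    [MulAction G T] [IsIsometricSMul G T] [MetricSpace T₁] [MulAction G T₁]
    [IsIsometricSMul G T₁] [MetricSpace T₂] [MulAction G T₂] [IsIsometricSMul G T₂]
    (hT : IsRTree T) (hT₁ : IsRTree T₁) (hT₂ : IsRTree T₂) {c : T} {c₁ : T₁} {c₂ : T₂}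
    (hd : ∀ x y : G, dist (x • c) (y • c) =
      dist (x • c₁) (y • c₁) + dist (x • c₂) (y • c₂)) : Compatible G T₁ T₂ := by
  let R : SubMulAction G T := subMulActionOfInvariant (orbitHull G c)
    fun g _ => smul_mem_orbitHull c g
  have hR : IsRTree R := (isArcConvex_orbitHull hT c).isRTree hT ⟨c, self_mem_orbitHull c⟩
  have : IsIsometricSMul G R := ⟨fun g => Isometry.of_dist_eq fun x y =>
    dist_smul g (x : T) (y : T)⟩
  let c' : R := ⟨c, self_mem_orbitHull c⟩
  have hhull : orbitHull G c' = univ := by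
    refine eq_univ_of_forall fun p => ?_
    obtain ⟨x, y, h⟩ := p.2
    exact ⟨x, y, h⟩
  have hd₁ : ∀ x y : G, dist (x • c') (y • c') =
      dist (x • c₁) (y • c₁) + dist (x • c₂) (y • c₂) := hd
  obtain ⟨f₁, hf₁, -⟩ := exists_map_of_dist_add hR hT₁ hT₂ hhull hd₁
  obtain ⟨f₂, hf₂, -⟩ := exists_map_of_dist_add hR hT₂ hT₁ hhull
    fun x y => (hd₁ x y).trans (add_comm _ _)
  exact ⟨R, inferInstance, inferInstance, this, hR, f₁, f₂, hf₁, hf₂⟩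

end RTrees

theorem theorem1p3 (G : Type v) [Group G] [Countable G] (T₁ T₂ : Type u)
    [MetricSpace T₁] [MulAction G T₁] [IsIsometricSMul G T₁]
    [MetricSpace T₂] [MulAction G T₂] [IsIsometricSMul G T₂]
    (hT₁ : RTrees.IsRTree T₁) (hT₂ : RTrees.IsRTree T₂)
    (hmin₁ : RTrees.IsMinimalTree G T₁) (hmin₂ : RTrees.IsMinimalTree G T₂)
    (hirr₁ : RTrees.IsIrreducibleTree G T₁) (hirr₂ : RTrees.IsIrreducibleTree G T₂) :
    -- compatibility is equivalent to the sum being a length function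
    (RTrees.Compatible G T₁ T₂ ↔
      RTrees.IsLengthFunction.{u} (fun g : G => RTrees.lengthFn T₁ g + RTrees.lengthFn T₂ g)) ∧
    -- the realizing tree is the standard common refinement, from whatever common refinement `R`
    -- the latter is constructed
    (∀ (R : Type u) [MetricSpace R] [MulAction G R] [IsIsometricSMul G R],
      RTrees.IsRTree R → ∀ (g₁ : R →[G] T₁) (g₂ : R →[G] T₂),
      RTrees.PreservesAlignment g₁ → RTrees.PreservesAlignment g₂ →
      (RTrees.IsRTree (RTrees.StdRefinement g₁ g₂) ∧
        RTrees.IsMinimalTree G (RTrees.StdRefinement g₁ g₂) ∧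
        RTrees.PreservesAlignment (RTrees.StdRefinement.fst g₁ g₂) ∧
        RTrees.PreservesAlignment (RTrees.StdRefinement.snd g₁ g₂) ∧
        ∀ g : G, RTrees.lengthFn (RTrees.StdRefinement g₁ g₂) g =
          RTrees.lengthFn T₁ g + RTrees.lengthFn T₂ g) ∧
      ∀ (T : Type u) [MetricSpace T] [MulAction G T] [IsIsometricSMul G T],
        RTrees.IsRTree T → RTrees.IsMinimalTree G T →
        (∀ g : G, RTrees.lengthFn T g = RTrees.lengthFn T₁ g + RTrees.lengthFn T₂ g) →
        ∃ e : T ≃ᵢ RTrees.StdRefinement g₁ g₂, ∀ (g : G) (x : T), e (g • x) = g • e x) := by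
  obtain ⟨c₁, c₂, hbase⟩ := RTrees.exists_base_points hT₁ hT₂ hirr₁ hirr₂
  refine ⟨⟨?_, ?_⟩, ?_⟩
  · rintro ⟨R, _, _, _, hR, g₁, g₂, h₁, h₂⟩
    have hS := RTrees.StdRefinement.isRTree hR h₁ h₂ hT₁ hT₂
    exact ⟨RTrees.StdRefinement g₁ g₂, inferInstance, inferInstance, inferInstance, hS,
      fun g => (RTrees.StdRefinement.lengthFn_eq hT₁ hT₂ hS g).symm⟩
  · rintro ⟨T, _, _, _, hT, hℓ⟩
    obtain ⟨c, hc⟩ := hbase T hT fun g => (hℓ g).symm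
    exact RTrees.compatible_of_lengthFn_add hT hT₁ hT₂ hc
  · intro R _ _ _ hR g₁ g₂ h₁ h₂
    have hS := RTrees.StdRefinement.isRTree hR h₁ h₂ hT₁ hT₂
    have hSℓ := RTrees.StdRefinement.lengthFn_eq hT₁ hT₂ hS
    have hSmin := RTrees.StdRefinement.isMinimalTree h₁ h₂ hS hmin₁ hmin₂
    refine ⟨⟨hS, hSmin, RTrees.StdRefinement.preservesAlignment_fst h₁ h₂,
      RTrees.StdRefinement.preservesAlignment_snd h₁ h₂, hSℓ⟩, ?_⟩
    intro T _ _ _ hT hmin hℓ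
    -- The same c₁ and c₂ serve for T and for T_s, so the orbits found in these trees have equal
    -- distances.
    obtain ⟨c, hc⟩ := hbase T hT hℓ
    obtain ⟨c', hc'⟩ := hbase (RTrees.StdRefinement g₁ g₂) hS hSℓ
    exact RTrees.exists_isometryEquiv_of_orbit hT hS hmin hSmin
      fun x y => (hc x y).trans (hc' x y).symm
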